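/- Let $k\ge 1$. A $k$-graph is a countable small category $\Lambda$ with a degree functor $d:\Lambda\to\mathbb N^k$ such that whenever $d(\lambda)=m+n$ there are unique morphisms $\mu,\nu$ with $\lambda=\mu\nu$, $d(\mu)=m$, $d(\nu)=n$. Morphisms are called paths, and objects (identified with their identity morphisms) are called vertices; $\Lambda^0$ is the set of vertices, and $r(\lambda)$, $s(\lambda)$ are the codomain and the domain of $\lambda$. For a vertex $v$ and $n\in\mathbb N^k$ put $v\Lambda^n=\{\lambda : r(\lambda)=v,\ d(\lambda)=n\}$. $\Lambda$ is row-finite (source-free) if every $v\Lambda^n$ is finite (non-empty). For such a row-finite, source-free $\Lambda$, $C^*(\Lambda)$ is the universal $C^*$-algebra generated by a Cuntz–Krieger $\Lambda$-family, that is, by partial isometries $t_\lambda$ ($\lambda\in\Lambda$) such that the $t_v$ ($v\in\Lambda^0$) are mutually orthogonal projections, $t_\lambda t_\eta=t_{\lambda\eta}$ if $s(\lambda)=r(\eta)$, $t_\lambda^*t_\lambda=t_{s(\lambda)}$, and $t_v=\sum_{\lambda\in v\Lambda^n}t_\lambda t_\lambda^*$ for all $v\in\Lambda^0$ and $n\in\mathbb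 N^k$. Let $\Omega_k$ be the category with object set $\mathbb N^k$ and one morphism $(p,q)$, with range $p$, source $q$ and degree $q-p$, for each $p\le q$. An infinite path is a degree-preserving functor $x:\Omega_k\to\Lambda$; its range is $r(x)=x(0)$. Write $\vec{\imath}=(i,\dots,i)$ and, for integers $0\le i\le j$, $x_{i,j}=x(\vec{\imath},\vec{\jmath})$. Let $F_i$ be the set of all paths with source $x(\vec{\imath})$, and let $(\xi^i_\mu)_{\mu\in F_i}$ be the standard basis of $\ell^2(F_i)$. Let $\mathcal H_x$ be the inductive limit of the Hilbert spaces $\ell^2(F_i)$, $i\ge 0$, under the isometries $\xi^i_\mu\mapsto\xi^{i+1}_{\mu x_{i,i+1}}$; thus $\mathcal H_x$ has as an orthonormal basis the classes $[\xi^i_\mu]$, where, for $i\le j$, $[\xi^i_\mu]=[\xi^j_\nu]$ if and only if $\nu=\mu x_{i,j}$. **Theorem.** Let $\Lambda$ be a row-finite, source-free $k$-graph. Then every vertex $v$ is the range of some infinite path. Moreover, for every choice of infinite paths $y_v$ with $r(y_v)=v$ $(v\in\Lambda^0)$: 1. for each $v$ there is a $*$-representation $\pi_{y_v}$ of $C^*(\Lambda)$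 on $\mathcal H_{y_v}$ such that $\pi_{y_v}(t_\lambda)[\xi^i_\mu]=[\xi^i_{\lambda\mu}]$ if $s(\lambda)=r(\mu)$ and $\pi_{y_v}(t_\lambda)[\xi^i_\mu]=0$ otherwise; 2. the Hilbert space $\mathcal H=\bigoplus_{v\in\Lambda^0}\mathcal H_{y_v}$ is separable, and the direct sum $\pi=\bigoplus_{v\in\Lambda^0}\pi_{y_v}$ is a faithful $*$-representation of $C^*(\Lambda)$ on $\mathcal H$. In particular, $C^*(\Lambda)$ has a faithful representation on a separable Hilbert space. -/

import Mathlib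

open CategoryTheory
open scoped ENNReal

universe u

noncomputable section

/-- A `k`-graph: a countable small category `Λ` with a degree functor to `ℕ^k` that has the
factorization property. A morphism `f : w ⟶ v` is a path with range `v` (its codomain) and
source `w` (its domain); the path usually written `f g` (with `s(f) = r(g)`) is the composite
`f ∘ g`, that is `g ≫ f`. Vertices are the objects, identified with the identity morphisms. -/
class HigherRankGraph (k : ℕ) (Λ : Type u) [SmallCategory Λ] where
  /-- The degree of a path. -/
  degree : ∀ {w v : Λ}, (w ⟶ v) → (Fin k → ℕ)
  degree_id : ∀ v : Λ, degree (𝟙 v) = 0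
  degree_comp : ∀ {u w v : Λ} (g : u ⟶ w) (f : w ⟶ v), degree (g ≫ f) = degree f + degree g
  countable_obj : Countable Λ
  countable_hom : ∀ w v : Λ, Countable (w ⟶ v)
  /-- If `d(f) = m + n`, then `f = μ ν` for a unique pair `μ, ν` with `d(μ) = m`, `d(ν) = n`.
  The triple `⟨a, ν, μ⟩` lists the middle vertex and the two factors. -/
  factorization : ∀ {w v : Λ} (f : w ⟶ v) (m n : Fin k → ℕ), degree f = m + n →
    ∃! p : (a : Λ) × (w ⟶ a) × (a ⟶ v),
      p.2.1 ≫ p.2.2 = f ∧ degree p.2.2 = m ∧ degree p.2.1 = n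

namespace HigherRankGraph

variable (k : ℕ) (Λ : Type u) [SmallCategory Λ] [HigherRankGraph k Λ]

/-- The degree functor, with `k` explicit. -/
abbrev deg {Λ : Type u} [SmallCategory Λ] [HigherRankGraph k Λ] {w v : Λ} (f : w ⟶ v) :
    Fin k → ℕ := degree f

/-- `v Λ^n`: the paths with range `v` and degree `n`. -/
abbrev PathsTo {Λ : Type u} [SmallCategory Λ] [HigherRankGraph k Λ] (v : Λ) (n : Fin k → ℕ) :
    Type u := (w : Λ) × {f : w ⟶ v // deg k f = n}

/-- `Λ` is row-finite: every `v Λ^n` is finite. -/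
def IsRowFinite : Prop := ∀ (v : Λ) (n : Fin k → ℕ), Finite (PathsTo k v n)

/-- `Λ` is source-free: every `v Λ^n` is non-empty. -/
def IsSourceFree : Prop := ∀ (v : Λ) (n : Fin k → ℕ), Nonempty (PathsTo k v n)

/-! ### Cuntz-Krieger families and the universal algebra -/

/-- A Cuntz-Krieger `Λ`-family in a C*-algebra `A` (for row-finite `Λ`, so that the sum in `ck4`
is a finite sum). -/
structure CKFamily (A : Type*) [NonUnitalCStarAlgebra A] where
  /-- The partial isometry attached to a path. -/
  t : ∀ {w v : Λ}, (w ⟶ v) → A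
  partialIsometry : ∀ {w v : Λ} (f : w ⟶ v), t f * star (t f) * t f = t f
  ck1_star : ∀ v : Λ, star (t (𝟙 v)) = t (𝟙 v)
  ck1_idem : ∀ v : Λ, t (𝟙 v) * t (𝟙 v) = t (𝟙 v)
  ck1_orth : ∀ v w : Λ, v ≠ w → t (𝟙 v) * t (𝟙 w) = 0
  ck2 : ∀ {u w v : Λ} (g : u ⟶ w) (f : w ⟶ v), t f * t g = t (g ≫ f)
  ck3 : ∀ {w v : Λ} (f : w ⟶ v), star (t f) * t f = t (𝟙 w)
  ck4 : ∀ (v : Λ) (n : Fin k → ℕ),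
    t (𝟙 v) = ∑ᶠ p : PathsTo k v n, t p.2.1 * star (t p.2.1)

variable {k Λ} in
theorem CKFamily.norm_t_le {A : Type*} [NonUnitalCStarAlgebra A] (S : CKFamily k Λ A)
    {w v : Λ} (f : w ⟶ v) : ‖S.t f‖ ≤ 1 := by
  have h1 : ‖S.t (𝟙 w)‖ * ‖S.t (𝟙 w)‖ = ‖S.t (𝟙 w)‖ := by
    rw [← CStarRing.norm_star_mul_self, S.ck1_star, S.ck1_idem]
  have h2 : ‖S.t f‖ * ‖S.t f‖ = ‖S.t (𝟙 w)‖ := by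
    rw [← CStarRing.norm_star_mul_self, S.ck3]
  have h3 : ‖S.t (𝟙 w)‖ ≤ 1 := by nlinarith [norm_nonneg (S.t (𝟙 w))]
  nlinarith [norm_nonneg (S.t f)]

/-- A C*-algebra together with a Cuntz-Krieger `Λ`-family in it. -/
structure CKPair : Type (u + 1) where
  /-- The algebra. -/
  A : Type u
  [inst : NonUnitalCStarAlgebra A]
  /-- The family. -/
  fam : CKFamily k Λ A

attribute [instance] CKPair.inst

/-- The C*-algebra of bounded elements of the product of all Cuntz-Krieger pairs. -/
abbrev CKProduct : Type (u + 1) := lp (fun S : CKPair k Λ => S.A) ∞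

/-- The element of the product whose coordinate at a family is that family's `t f`. -/
def prodGen {Λ : Type u} [SmallCategory Λ] [HigherRankGraph k Λ] {w v : Λ} (f : w ⟶ v) :
    CKProduct k Λ :=
  ⟨fun S => S.fam.t f, memℓp_infty ⟨1, by rintro _ ⟨S, rfl⟩; exact S.fam.norm_t_le f⟩⟩

/-- The set of the generators of `C*(Λ)`. -/
def genSet : Set (CKProduct k Λ) := {a | ∃ (w v : Λ) (f : w ⟶ v), a = prodGen k f}

/-- `C*(Λ)`, the universal C*-algebra generated by a Cuntz-Krieger `Λ`-family, realised as the
C*-subalgebra generated by the diagonal family in the product of all Cuntz-Krieger families.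
The facts `universalFamily` and `existsUnique_lift` below state its universal property. -/
def cstarSubalgebra : NonUnitalStarSubalgebra ℂ (CKProduct k Λ) :=
  (NonUnitalStarAlgebra.adjoin ℂ (genSet k Λ)).topologicalClosure

/-- `C*(Λ)` as a type. -/
abbrev CStar : Type (u + 1) := cstarSubalgebra k Λ

instance : IsClosed (cstarSubalgebra k Λ : Set (CKProduct k Λ)) :=
  NonUnitalStarSubalgebra.isClosed_topologicalClosure _

instance : NonUnitalCStarAlgebra (CStar k Λ) :=
  NonUnitalStarSubalgebra.nonUnitalCStarAlgebra (cstarSubalgebra k Λ)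

/-- The canonical generator `t_f` of `C*(Λ)`. -/
def gen {Λ : Type u} [SmallCategory Λ] [HigherRankGraph k Λ] {w v : Λ} (f : w ⟶ v) :
    CStar k Λ :=
  ⟨prodGen k f, NonUnitalStarSubalgebra.le_topologicalClosure _
    (NonUnitalStarAlgebra.subset_adjoin ℂ _ ⟨w, v, f, rfl⟩)⟩

/-- The coordinate of an element of `C*(Λ)` at a Cuntz-Krieger pair, as a *-homomorphism. -/
def coord (S : CKPair k Λ) : CStar k Λ →⋆ₙₐ[ℂ] S.A where
  toFun a := (a : CKProduct k Λ) S
  map_smul' _ _ := rfl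
  map_zero' := rfl
  map_add' _ _ := rfl
  map_mul' _ _ := rfl
  map_star' _ := rfl

theorem coord_gen (S : CKPair k Λ) {w v : Λ} (f : w ⟶ v) :
    coord k Λ S (gen k f) = S.fam.t f := rfl

theorem ext_coord {a b : CStar k Λ} (h : ∀ S, coord k Λ S a = coord k Λ S b) : a = b :=
  Subtype.ext (lp.ext (funext h))

/-- The canonical generators of `C*(Λ)` form a Cuntz-Krieger `Λ`-family. -/
def universalFamily (hrow : IsRowFinite k Λ) : CKFamily k Λ (CStar k Λ) where
  t f := gen k f
  partialIsometry f := ext_coord k Λ fun S => by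
    simpa only [map_mul, map_star, coord_gen] using S.fam.partialIsometry f
  ck1_star v := ext_coord k Λ fun S => by
    simpa only [map_star, coord_gen] using S.fam.ck1_star v
  ck1_idem v := ext_coord k Λ fun S => by
    simpa only [map_mul, coord_gen] using S.fam.ck1_idem v
  ck1_orth v w h := ext_coord k Λ fun S => by
    simpa only [map_mul, map_zero, coord_gen] using S.fam.ck1_orth v w h
  ck2 g f := ext_coord k Λ fun S => by
    simpa only [map_mul, coord_gen] using S.fam.ck2 g f
  ck3 f := ext_coord k Λ fun S => by
    simpa only [map_mul, map_star, coord_gen] using S.fam.ck3 f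
  ck4 v n := ext_coord k Λ fun S => by
    have := hrow v n
    have := Fintype.ofFinite (PathsTo k v n)
    have h := S.fam.ck4 v n
    rw [finsum_eq_sum_of_fintype] at h ⊢
    simpa only [map_sum, map_mul, map_star, coord_gen] using h

/-- The universal property: a Cuntz-Krieger `Λ`-family in a C*-algebra is the image of the
canonical one under a unique *-homomorphism on `C*(Λ)`. -/
theorem existsUnique_lift (B : Type u) [NonUnitalCStarAlgebra B] (S : CKFamily k Λ B) :
    ∃! φ : CStar k Λ →⋆ₙₐ[ℂ] B, ∀ (w v : Λ) (f : w ⟶ v), φ (gen k f) = S.t f := by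
  refine ⟨coord k Λ ⟨B, S⟩, fun _ _ f => coord_gen k Λ ⟨B, S⟩ f, fun φ hφ => ?_⟩
  refine NonUnitalStarAlgHom.ext fun a => ?_
  have hc : ∀ ψ : CStar k Λ →⋆ₙₐ[ℂ] B, Continuous ψ := fun ψ =>
    AddMonoidHomClass.continuous_of_bound ψ 1 fun x => by
      simpa using NonUnitalStarAlgHom.norm_apply_le ψ x
  obtain ⟨a, ha⟩ := a
  have key : ∀ b (hb : b ∈ NonUnitalStarAlgebra.adjoin ℂ (genSet k Λ)),
      φ ⟨b, NonUnitalStarSubalgebra.le_topologicalClosure _ hb⟩ =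
        coord k Λ ⟨B, S⟩ ⟨b, NonUnitalStarSubalgebra.le_topologicalClosure _ hb⟩ := by
    intro b hb
    induction hb using NonUnitalStarAlgebra.adjoin_induction with
    | mem x hx => obtain ⟨w, v, f, rfl⟩ := hx; exact hφ w v f
    | add x y hx hy h1 h2 =>
      have h := congrArg₂ (· + ·) h1 h2
      simp only [← map_add] at h; exact h
    | zero => exact (map_zero φ).trans (map_zero _).symm
    | mul x y hx hy h1 h2 =>
      have h := congrArg₂ (· * ·) h1 h2
      simp only [← map_mul] at h; exact h
    | smul r x hx h1 =>
      have h := congrArg (r • ·) h1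
      simp only [← map_smul] at h; exact h
    | star x hx h1 =>
      have h := congrArg star h1
      simp only [← map_star] at h; exact h
  have hcl : IsClosed {a : CStar k Λ | φ a = coord k Λ ⟨B, S⟩ a} :=
    isClosed_eq (hc _) (hc _)
  have hd : (⟨a, ha⟩ : CStar k Λ) ∈ closure {a : CStar k Λ | φ a = coord k Λ ⟨B, S⟩ a} := by
    rw [closure_subtype]
    refine closure_mono ?_ ha
    intro b hb
    exact ⟨⟨b, NonUnitalStarSubalgebra.le_topologicalClosure _ hb⟩, key b hb, rfl⟩
  rw [hcl.closure_eq] at hd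
  exact hd

/-! ### Infinite paths and the inductive-limit Hilbert spaces -/

/-- The objects of the category `Ω_k`: the elements of `ℕ^k`. -/
structure Omega (k : ℕ) : Type where
  /-- The underlying element of `ℕ^k`. -/
  pt : Fin k → ℕ

/-- For `p ≤ q` in `ℕ^k`, the category `Ω_k` has one morphism `(p, q)` with range `p` and
source `q`, and no other morphisms. -/
instance omegaCategory (k : ℕ) : SmallCategory (Omega k) where
  Hom q p := PLift (p.pt ≤ q.pt)
  id p := ⟨le_rfl⟩
  comp f g := ⟨g.down.trans f.down⟩

/-- The morphism `(p, q)` of `Ω_k`. -/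
def Omega.hom {k : ℕ} {p q : Fin k → ℕ} (h : p ≤ q) : Omega.mk q ⟶ Omega.mk p := PLift.up h

/-- An infinite path: a degree-preserving functor from `Ω_k` to `Λ`, where `(p, q)` has degree
`q - p`. -/
structure InfinitePath where
  /-- The underlying functor. -/
  toFunctor : Omega k ⥤ Λ
  degree_map : ∀ {p q : Fin k → ℕ} (h : p ≤ q), deg k (toFunctor.map (Omega.hom h)) = q - p

variable {k Λ}

namespace InfinitePath

variable (x : InfinitePath k Λ)

/-- The range `x(0)` of an infinite path. -/
def range : Λ := x.toFunctor.obj ⟨0⟩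

/-- The `i`-th vertex `x(i, …, i)` on the diagonal, `i = 0, 1, 2, …`. -/
def vertex (i : ℕ) : Λ := x.toFunctor.obj ⟨fun _ => i⟩

/-- The segment `x((i, …, i), (j, …, j)) = x_i x_{i+1} ⋯ x_{j-1}`, where each `x_l` has degree
`(1, …, 1)`. -/
def seg {i j : ℕ} (h : i ≤ j) : x.vertex j ⟶ x.vertex i :=
  x.toFunctor.map (Omega.hom (show (fun _ : Fin k => i) ≤ fun _ => j from fun _ => h))

/-- `F_i`: the paths whose source is the `i`-th vertex of `x`. -/
abbrev F (i : ℕ) : Type u := (v : Λ) × (x.vertex i ⟶ v)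

/-- The map `F_i → F_j`, `μ ↦ μ x_i ⋯ x_{j-1}`. -/
def extend {i j : ℕ} (h : i ≤ j) (μ : x.F i) : x.F j := ⟨μ.1, x.seg h ≫ μ.2⟩

theorem extend_refl {i : ℕ} (μ : x.F i) : x.extend le_rfl μ = μ := by
  obtain ⟨v, μ⟩ := μ
  have : x.seg (le_refl i) = 𝟙 _ := x.toFunctor.map_id _
  simp [extend, this]

theorem extend_extend {i j l : ℕ} (h : i ≤ j) (h' : j ≤ l) (μ : x.F i) :
    x.extend h' (x.extend h μ) = x.extend (h.trans h') μ := by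
  have : x.seg h' ≫ x.seg h = x.seg (h.trans h') := (x.toFunctor.map_comp _ _).symm
  simp [extend, ← this]

theorem extend_injective {i j : ℕ} (h : i ≤ j) : Function.Injective (x.extend h) := by
  rintro ⟨v, μ⟩ ⟨v', ν⟩ he
  simp only [extend, Sigma.mk.injEq] at he
  obtain ⟨rfl, he⟩ := he
  have he := eq_of_heq he
  have hd : deg k μ = deg k ν := by
    have := congrArg (deg k) he
    simp only [deg, degree_comp] at this
    exact add_right_cancel this
  obtain ⟨p, -, hp⟩ := factorization (k := k) (x.seg h ≫ μ) (deg k μ) (deg k (x.seg h))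
    (degree_comp _ _)
  have h1 := hp ⟨_, x.seg h, μ⟩ ⟨rfl, rfl, rfl⟩
  have h2 := hp ⟨_, x.seg h, ν⟩ ⟨he.symm, hd.symm, rfl⟩
  have h3 := h1.trans h2.symm
  simp only [Sigma.mk.injEq, heq_eq_eq, true_and, Prod.mk.injEq] at h3
  rw [h3]

/-- The relation on generators: for `i ≤ j`, `ξ^i_μ ∼ ξ^j_ν` iff `ν = μ x_i ⋯ x_{j-1}`. -/
def Rel (p q : (i : ℕ) × x.F i) : Prop :=
  (∃ h : p.1 ≤ q.1, q.2 = x.extend h p.2) ∨ (∃ h : q.1 ≤ p.1, p.2 = x.extend h q.2)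

theorem rel_iff (p q : (i : ℕ) × x.F i) : x.Rel p q ↔
    ∃ (l : ℕ) (hp : p.1 ≤ l) (hq : q.1 ≤ l), x.extend hp p.2 = x.extend hq q.2 := by
  constructor
  · rintro (⟨h, e⟩ | ⟨h, e⟩)
    · exact ⟨q.1, h, le_rfl, by rw [extend_refl, e]⟩
    · exact ⟨p.1, le_rfl, h, by rw [extend_refl, e]⟩
  · rintro ⟨l, hp, hq, e⟩
    rcases le_total p.1 q.1 with h | h
    · refine Or.inl ⟨h, x.extend_injective hq ?_⟩
      rw [extend_extend, e]
    · refine Or.inr ⟨h, x.extend_injective hp ?_⟩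
      rw [extend_extend, e]

/-- `∼` is an equivalence relation on the set of all generators `ξ^i_μ`. -/
instance genSetoid : Setoid ((i : ℕ) × x.F i) where
  r := x.Rel
  iseqv :=
    { refl := fun p => Or.inl ⟨le_rfl, (x.extend_refl _).symm⟩
      symm := fun h => Or.symm h
      trans := by
        intro p q r h1 h2
        rw [rel_iff] at h1 h2 ⊢
        obtain ⟨l, hp, hq, e⟩ := h1
        obtain ⟨m, hq', hr, e'⟩ := h2
        refine ⟨max l m, hp.trans (le_max_left _ _), hr.trans (le_max_right _ _), ?_⟩
        rw [← x.extend_extend hp (le_max_left l m), e, extend_extend,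
          ← x.extend_extend hr (le_max_right l m), ← e', extend_extend] }

/-- The set of classes of generators, `(⊔ F_i)/∼`. -/
abbrev GenClass : Type u := Quotient x.genSetoid

open Classical in
/-- The standard basis vector of `ℓ²(α)` at `a`. -/
def basisVec {α : Type u} (a : α) : lp (fun _ : α => ℂ) 2 := lp.single 2 a (1 : ℂ)

/-- The Hilbert space `H_x`, the inductive limit of the spaces `ℓ²(F_i)` under the isometries
`ρ_i ξ^i_μ = ξ^{i+1}_{μ x_i}`: the Hilbert space that has the classes of generators as an
orthonormal basis. The fact `isInductiveLimit` below states that it is the inductive limit. -/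
abbrev H : Type u := lp (fun _ : x.GenClass => ℂ) 2

/-- The vector `[ξ^i_μ]` of `H_x`. -/
def ξ (i : ℕ) {v : Λ} (μ : x.vertex i ⟶ v) : x.H :=
  basisVec (Quotient.mk x.genSetoid ⟨i, ⟨v, μ⟩⟩)

open Classical in
/-- An injection of index sets induces an isometry of `ℓ²` spaces on the basis vectors. -/
theorem exists_basisIsometry {α β : Type u} (g : α → β) (hg : Function.Injective g) :
    ∃ V : lp (fun _ : α => ℂ) 2 →ₗᵢ[ℂ] lp (fun _ : β => ℂ) 2,
      ∀ a, V (basisVec a) = basisVec (g a) := by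
  have ho : Orthonormal ℂ fun a : α => basisVec (g a) := by
    rw [orthonormal_iff_ite]
    intro a b
    rw [basisVec, basisVec, lp.inner_single_left, lp.single_apply, Pi.single_apply]
    by_cases h : a = b <;> simp [h, hg.eq_iff]
  refine ⟨ho.orthogonalFamily.linearIsometry, fun a => ?_⟩
  rw [basisVec, OrthogonalFamily.linearIsometry_apply_single]
  simp

open Classical in
theorem dense_span_basisVec (α : Type u) :
    Dense (Submodule.span ℂ (Set.range (basisVec (α := α))) : Set (lp (fun _ : α => ℂ) 2)) := by
  intro f
  refine mem_closure_of_tendsto (lp.hasSum_single (by norm_num) f)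
    (Filter.Eventually.of_forall fun s => ?_)
  refine Submodule.sum_mem _ fun a _ => ?_
  have : (lp.single 2 a (f a) : lp (fun _ : α => ℂ) 2) = f a • basisVec a := by
    rw [basisVec, ← lp.single_smul]; simp
  rw [this]
  exact Submodule.smul_mem _ _ (Submodule.subset_span ⟨a, rfl⟩)

/-- `H_x` is the inductive limit of the system `(ℓ²(F_i), ρ_i)`: there are isometries
`ρ_i ξ^i_μ = ξ^{i+1}_{μ x_i}` and isometries `ι_i : ℓ²(F_i) → H_x`, `ι_i ξ^i_μ = [ξ^i_μ]`, with
`ι_{i+1} ρ_i = ι_i`, such that the increasing union of the ranges of the `ι_i` is dense. -/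
theorem isInductiveLimit :
    ∃ (ρ : ∀ i, lp (fun _ : x.F i => ℂ) 2 →ₗᵢ[ℂ] lp (fun _ : x.F (i + 1) => ℂ) 2)
      (ι : ∀ i, lp (fun _ : x.F i => ℂ) 2 →ₗᵢ[ℂ] x.H),
      (∀ i (μ : x.F i), ρ i (basisVec μ) = basisVec (x.extend (Nat.le_succ i) μ)) ∧
      (∀ i (μ : x.F i), ι i (basisVec μ) = x.ξ i μ.2) ∧
      (∀ i a, ι (i + 1) (ρ i a) = ι i a) ∧
      Dense (⋃ i, Set.range (ι i)) := by
  have hinj : ∀ i, Function.Injective fun μ : x.F i => Quotient.mk x.genSetoid ⟨i, μ⟩ := by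
    intro i μ ν h
    have h : x.Rel ⟨i, μ⟩ ⟨i, ν⟩ := Quotient.exact h
    rw [rel_iff] at h
    obtain ⟨l, hp, hq, e⟩ := h
    exact x.extend_injective hp e
  choose ρ hρ using fun i => exists_basisIsometry _ (x.extend_injective (Nat.le_succ i))
  choose ι hι using fun i => exists_basisIsometry _ (hinj i)
  have hcomp : ∀ i a, ι (i + 1) (ρ i a) = ι i a := by
    intro i a
    have : (fun a => ι (i + 1) (ρ i a)) = fun a => ι i a := by
      refine Continuous.ext_on (dense_span_basisVec (x.F i))
        ((ι (i + 1)).continuous.comp (ρ i).continuous) (ι i).continuous ?_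
      intro b hb
      refine LinearMap.eqOn_span (f := ((ι (i + 1)).comp (ρ i)).toLinearMap)
        (g := (ι i).toLinearMap) ?_ hb
      rintro _ ⟨μ, rfl⟩
      change ι (i + 1) (ρ i _) = ι i _
      rw [hρ, hι, hι]
      congr 1
      exact Quotient.sound (Or.inr ⟨Nat.le_succ i, rfl⟩)
    exact congrFun this a
  refine ⟨ρ, ι, hρ, fun i μ => hι i μ, hcomp, ?_⟩
  have hmono : Monotone fun i => LinearMap.range (ι i).toLinearMap := by
    refine monotone_nat_of_le_succ fun i => ?_
    rintro _ ⟨a, rfl⟩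
    exact ⟨ρ i a, hcomp i a⟩
  refine (dense_span_basisVec x.GenClass).mono ?_
  have hle : Submodule.span ℂ (Set.range (basisVec (α := x.GenClass))) ≤
      ⨆ i, LinearMap.range (ι i).toLinearMap := by
    rw [Submodule.span_le]
    rintro _ ⟨a, rfl⟩
    induction a using Quotient.inductionOn with
    | h p =>
      obtain ⟨i, μ⟩ := p
      exact Submodule.mem_iSup_of_mem i ⟨basisVec μ, hι i μ⟩
  intro b hb
  obtain ⟨i, hi⟩ := (Submodule.mem_iSup_of_directed _ hmono.directed_le).1 (hle hb)
  exact Set.mem_iUnion.2 ⟨i, hi⟩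

/-- `π` is the representation `π_x` on `H_x`: it maps `t_f` to the operator `T_f` with
`T_f [ξ^i_μ] = [ξ^i_{f μ}]` if `s(f) = r(μ)` and `T_f [ξ^i_μ] = 0` otherwise. Such a `π` is unique,
as the vectors `[ξ^i_μ]` span a dense subspace and the `t_f` generate `C*(Λ)`. -/
def IsPathRepresentation (π : CStar k Λ →⋆ₙₐ[ℂ] (x.H →L[ℂ] x.H)) : Prop :=
  (∀ {w v : Λ} (f : w ⟶ v) (i : ℕ) (μ : x.vertex i ⟶ w),
    π (gen k f) (x.ξ i μ) = x.ξ i (μ ≫ f)) ∧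
  (∀ {w v a : Λ} (f : w ⟶ v) (i : ℕ) (μ : x.vertex i ⟶ a), w ≠ a →
    π (gen k f) (x.ξ i μ) = 0)

end InfinitePath

/-- The Hilbert-space direct sum of the spaces `H_{y v}` over all vertices `v`. -/
abbrev SumSpace (y : Λ → InfinitePath k Λ) : Type u := lp (fun v : Λ => (y v).H) 2

end HigherRankGraph

end

/-! The translations `[μ] ↦ [f μ]` are partial bijections of the orthonormal basis of `H_x`: they
are injective because paths cancel on the left. The operators they induce have the inverse partial
bijections as adjoints. They satisfy the last Cuntz–Krieger relation because a class with range `v`,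
represented by a long enough path, factors through exactly one path of degree `n` with range `v`.
The universal property then gives each `π_x`.

Faithfulness is a gauge-invariant uniqueness argument (`injective_of_gaugeMean`). Averaging over the
torus action is a map `Φ` onto the closed span of the `t_p t_q*` with `d(p) = d(q)`, and `Φ(a* a) =
0` forces `a = 0`, since the integrand is continuous and positive. A *-homomorphism that kills no
vertex projection is isometric on that span, an increasing union of algebras each element of which
lies in a finite-dimensional *-algebra spanned by matrix units
(`CKFamily.norm_map_of_mem_coreSpan`). So it suffices that `ker π` is stable under `Φ`.

This stability needs no unitaries on `H_x`. The classes carry a `ℤ^k`-degree `d(μ) - (i, …, i)`, and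
`t_p t_q*` shifts it by `d(p) - d(q)`. Hence the matrix of `π_x(Φ(a))` is that of `π_x(a)` with the
entries between different degrees deleted (`InfinitePath.pathRep_gaugeMean_basisVec`). No vertex
projection dies in the direct sum, because `t_v` fixes the class of the trivial path in `H_{y_v}`.
Separability is countability of the set of paths. -/

noncomputable section

namespace HigherRankGraph

/-! ### Unique factorization and the existence of infinite paths -/

section Graph

section Factorization

variable {k : ℕ} {Λ : Type u} [SmallCategory Λ] [HigherRankGraph k Λ]

variable (k) in
/-- Uniqueness of factorizations, with the middle vertex packaged on the left factors. -/
theorem sigma_eq_of_comp_eq {w a b v : Λ} {g : w ⟶ a} {f : a ⟶ v} {g' : w ⟶ b} {f' : b ⟶ v}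
    (h : g ≫ f = g' ≫ f') (hd : deg k f = deg k f') :
    (⟨a, g, f⟩ : (a : Λ) × (w ⟶ a) × (a ⟶ v)) = ⟨b, g', f'⟩ := by
  have hd' : deg k g = deg k g' := by
    have := congrArg (deg k) h
    simp only [deg, degree_comp] at this
    simp only [deg] at hd
    rw [hd] at this
    exact add_left_cancel this
  exact (factorization (k := k) (g ≫ f) (deg k f) (deg k g) (degree_comp _ _)).unique
    ⟨rfl, rfl, rfl⟩ ⟨h.symm, hd.symm, hd'.symm⟩

theorem comp_right_cancel (k : ℕ) {Λ : Type u} [SmallCategory Λ] [HigherRankGraph k Λ]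
    {w a v : Λ} {g g' : w ⟶ a} {f : a ⟶ v} (h : g ≫ f = g' ≫ f) :
    g = g' := by
  have := sigma_eq_of_comp_eq k h rfl
  simp only [Sigma.mk.injEq, heq_eq_eq, true_and, Prod.mk.injEq] at this
  exact this.1

theorem exists_factor {w v : Λ} (f : w ⟶ v) {n : Fin k → ℕ} (h : n ≤ deg k f) :
    ∃ (a : Λ) (p : a ⟶ v) (g : w ⟶ a), g ≫ p = f ∧ deg k p = n ∧ deg k g = deg k f - n := by
  obtain ⟨⟨a, g, p⟩, ⟨h1, h2, h3⟩, -⟩ :=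
    factorization (k := k) f n (deg k f - n) (add_tsub_cancel_of_le h).symm
  exact ⟨a, p, g, h1, h2, h3⟩

-- `𝟙 w ≫ f` and `f ≫ 𝟙 v` factor the same path with range-side factors of degree zero, so their
-- middle vertices `w` and `v` coincide.
variable (k) in
theorem eq_of_degree_eq_zero {w v : Λ} (f : w ⟶ v) (h : deg k f = 0) : w = v := by
  have := sigma_eq_of_comp_eq k (g := 𝟙 w) (f := f) (g' := f) (f' := 𝟙 v) (by simp)
    (h.trans (degree_id v).symm)
  exact congrArg Sigma.fst this

/-- In a source-free graph every vertex is the range of a path of each degree. -/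
theorem exists_path (hsrc : IsSourceFree k Λ) (v : Λ) (n : Fin k → ℕ) :
    ∃ (w : Λ) (f : w ⟶ v), deg k f = n := by
  obtain ⟨⟨w, f, h⟩⟩ := hsrc v n
  exact ⟨w, f, h⟩

/-- In a source-free graph every vertex is the range of an infinite path. -/
theorem exists_infinitePath (hsrc : IsSourceFree k Λ) (v : Λ) :
    ∃ x : InfinitePath k Λ, x.range = v := by
  choose nxt e he using fun w : Λ => exists_path hsrc w (fun _ : Fin k => 1)
  -- The path of degree `(i, …, i)` obtained by composing `i` chosen paths.
  let P : ℕ → (w : Λ) × (w ⟶ v) := fun i =>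
    Nat.rec ⟨v, 𝟙 v⟩ (fun _ p => ⟨nxt p.1, e p.1 ≫ p.2⟩) i
  have hPdeg : ∀ i, deg k (P i).2 = fun _ => i := by
    intro i
    induction i with
    | zero => exact degree_id v
    | succ i ih =>
      change degree (e (P i).1 ≫ (P i).2) = _
      rw [degree_comp, show degree (e (P i).1) = _ from he _, show degree (P i).2 = _ from ih]
      rfl
  have hPle : ∀ {i j : ℕ}, i ≤ j → ∃ g : (P j).1 ⟶ (P i).1, g ≫ (P i).2 = (P j).2 := by
    intro i j hij
    induction hij with
    | refl => exact ⟨𝟙 _, by simp⟩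
    | step _ ih =>
      obtain ⟨g, hg⟩ := ih
      refine ⟨e _ ≫ g, ?_⟩
      rw [Category.assoc, hg]
  -- The coordinate sum is a monotone choice of an `N` with `n ≤ (N, …, N)`. The initial segment
  -- `x(0, n)` is cut off `P N` and called `p n`.
  have hbound : ∀ n : Fin k → ℕ, n ≤ fun _ => ∑ i, n i := fun n i =>
    Finset.single_le_sum (f := n) (fun _ _ => Nat.zero_le _) (Finset.mem_univ i)
  choose hd p r hpr hp hr using fun n : Fin k → ℕ =>
    exists_factor (P (∑ i, n i)).2 (n := n) ((hbound n).trans_eq (hPdeg _).symm)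
  have hseg : ∀ {m n : Fin k → ℕ}, m ≤ n → ∃ g : hd n ⟶ hd m, g ≫ p m = p n := by
    intro m n hmn
    obtain ⟨a, q, g, hgq, hq, -⟩ := exists_factor (p n) (n := m) (hmn.trans_eq (hp n).symm)
    obtain ⟨t, ht⟩ := hPle (Finset.sum_le_sum fun i (_ : i ∈ Finset.univ) => hmn i)
    -- Both composites are the longer path `P (∑ i, n i)`, so its initial segments `q` and `p m` of
    -- degree `m` agree.
    have h := sigma_eq_of_comp_eq k (g := r n ≫ g) (f := q) (g' := t ≫ r m) (f' := p m)
      (by rw [Category.assoc, hgq, hpr, Category.assoc, hpr, ht]) (hq.trans (hp m).symm)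
    obtain rfl := congrArg Sigma.fst h
    simp only [Sigma.mk.injEq, heq_eq_eq, true_and, Prod.mk.injEq] at h
    exact ⟨g, by rw [← h.2, hgq]⟩
  choose s hs using fun (m n : Omega k) (h : m.pt ≤ n.pt) => hseg h
  -- Cancelling the initial segment `p` makes each `s m n` unique, which yields functoriality.
  let F : Omega k ⥤ Λ :=
    { obj := fun n => hd n.pt
      map := fun {n m} h => s m n h.down
      map_id := fun n => comp_right_cancel k (f := p n.pt) (by rw [hs]; simp)
      map_comp := fun {n m l} f g => comp_right_cancel k (f := p l.pt) (by
        rw [hs, Category.assoc, hs, hs]) }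
  refine ⟨⟨F, fun {m n} h => ?_⟩, eq_of_degree_eq_zero k (p 0) (hp 0)⟩
  have h1 := congrArg (deg k) (hs ⟨m⟩ ⟨n⟩ h)
  simp only [deg, degree_comp] at h1
  have h2 : degree (p m) = m := hp m
  have h3 : degree (p n) = n := hp n
  rw [h2, h3] at h1
  change degree (s ⟨m⟩ ⟨n⟩ h) = _
  exact eq_tsub_of_add_eq ((add_comm _ _).trans h1)

end Factorization

end Graph

/-! ### Cuntz–Krieger families and isometry on the core -/

section Families

section CStarPositivity

/-- In a C*-algebra, a vanishing finite sum of elements `a* a` has only vanishing terms. -/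
theorem eq_zero_of_sum_star_mul_self_eq_zero {A ι : Type*} [NonUnitalCStarAlgebra A]
    {s : Finset ι} {a : ι → A} (h : ∑ i ∈ s, star (a i) * a i = 0) {i : ι} (hi : i ∈ s) :
    a i = 0 := by
  let _ := CStarAlgebra.spectralOrder A
  have _ := CStarAlgebra.spectralOrderedRing A
  have h0 := (Finset.sum_eq_zero_iff_of_nonneg fun j _ => star_mul_self_nonneg (a j)).1 h i hi
  exact CStarRing.star_mul_self_eq_zero_iff _ |>.1 h0

/-- An injective *-homomorphism of a finite-dimensional *-subalgebra of a C*-algebra is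
isometric. -/
theorem norm_map_of_finiteDimensional {A B : Type*} [NonUnitalCStarAlgebra A]
    [NonUnitalCStarAlgebra B] (φ : A →⋆ₙₐ[ℂ] B) (D : NonUnitalStarSubalgebra ℂ A)
    (hfin : FiniteDimensional ℂ D.toSubmodule) (hinj : ∀ a ∈ D, φ a = 0 → a = 0)
    {a : A} (ha : a ∈ D) : ‖φ a‖ = ‖a‖ := by
  -- Being closed, `D` is itself a C*-algebra, and injective *-homomorphisms of C*-algebras are
  -- isometric.
  have hcl : IsClosed (D : Set A) := D.toSubmodule.closed_of_finiteDimensional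
  let _ := NonUnitalStarSubalgebra.nonUnitalCStarAlgebra D
  refine NonUnitalStarAlgHom.norm_map (φ.comp (NonUnitalStarSubalgebraClass.subtype D))
    ((injective_iff_map_eq_zero _).2 fun b hb => ?_) ⟨a, ha⟩
  exact Subtype.ext (hinj b b.2 hb)

end CStarPositivity

variable (k : ℕ) (Λ : Type u) [SmallCategory Λ] [HigherRankGraph k Λ]

/-- The paths of `Λ`, as triples of source, range and path. -/
abbrev Path (Λ : Type u) [SmallCategory Λ] : Type u := (w : Λ) × (v : Λ) × (w ⟶ v)

namespace CKFamily

variable {k Λ} {A : Type*} [NonUnitalCStarAlgebra A] (S : CKFamily k Λ A)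

theorem t_mul_id {w v : Λ} (f : w ⟶ v) : S.t f * S.t (𝟙 w) = S.t f := by
  rw [S.ck2, Category.id_comp]

theorem id_mul_t {w v : Λ} (f : w ⟶ v) : S.t (𝟙 v) * S.t f = S.t f := by
  rw [S.ck2, Category.comp_id]

theorem star_t_mul_id {w v : Λ} (f : w ⟶ v) : star (S.t f) * S.t (𝟙 v) = star (S.t f) := by
  rw [← S.ck1_star, ← star_mul, S.id_mul_t]

theorem id_mul_star_t {w v : Λ} (f : w ⟶ v) : S.t (𝟙 w) * star (S.t f) = star (S.t f) := by
  rw [← S.ck1_star, ← star_mul, S.t_mul_id]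

theorem t_mul_t_of_ne {a w w' v : Λ} (f : w ⟶ v) (g : a ⟶ w') (h : w ≠ w') :
    S.t f * S.t g = 0 := by
  rw [← S.t_mul_id f, ← S.id_mul_t g, mul_assoc, ← mul_assoc (S.t (𝟙 w)), S.ck1_orth _ _ h]
  simp

theorem t_mul_star_of_ne {w w' v v' : Λ} (f : w ⟶ v) (g : w' ⟶ v') (h : w ≠ w') :
    S.t f * star (S.t g) = 0 := by
  rw [← S.t_mul_id f, ← S.id_mul_star_t g, mul_assoc, ← mul_assoc (S.t (𝟙 w)),
    S.ck1_orth _ _ h]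
  simp

theorem star_t_mul_of_ne {w w' v v' : Λ} (f : w ⟶ v) (g : w' ⟶ v') (h : v ≠ v') :
    star (S.t f) * S.t g = 0 := by
  rw [← S.star_t_mul_id f, ← S.id_mul_t g, mul_assoc, ← mul_assoc (S.t (𝟙 v)),
    S.ck1_orth _ _ h]
  simp

/-- `ck4` as a finite sum. -/
theorem id_eq_sum (v : Λ) (n : Fin k → ℕ) [Fintype (PathsTo k v n)] :
    S.t (𝟙 v) = ∑ p : PathsTo k v n, S.t p.2.1 * star (S.t p.2.1) := by
  rw [S.ck4 v n, finsum_eq_sum_of_fintype]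

/-- Paths of equal degree and range have orthogonal range projections. -/
theorem star_t_mul_t_of_pathsTo_ne (hrow : IsRowFinite k Λ) {v : Λ} {n : Fin k → ℕ}
    (p q : PathsTo k v n) (h : p ≠ q) : star (S.t p.2.1) * S.t q.2.1 = 0 := by
  classical
  have := hrow v n
  have := Fintype.ofFinite (PathsTo k v n)
  -- When `ck4` expands `t_v`, the `q`-term alone already gives the right-hand side. The other terms
  -- `(t_p* t_q)* (t_p* t_q)` therefore sum to zero, and by positivity each vanishes.
  have h1 : star (S.t q.2.1) * S.t (𝟙 v) * S.t q.2.1 = S.t (𝟙 q.1) := by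
    rw [S.star_t_mul_id, S.ck3]
  rw [S.id_eq_sum v n, ← Finset.add_sum_erase _ _ (Finset.mem_univ q), mul_add, add_mul,
    ← mul_assoc, S.ck3, mul_assoc, S.ck3, S.ck1_idem, add_eq_left, Finset.mul_sum,
    Finset.sum_mul] at h1
  refine eq_zero_of_sum_star_mul_self_eq_zero (s := Finset.univ.erase q)
    (a := fun p : PathsTo k v n => star (S.t p.2.1) * S.t q.2.1) ?_ (i := p) (by simp [h])
  rw [← h1]
  exact Finset.sum_congr rfl fun p _ => by simp [mul_assoc]

/-- The generator attached to a path given as a triple. -/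
def T (p : Path Λ) : A := S.t p.2.2

theorem T_mul_id (p : Path Λ) (v : Λ) : S.T p * S.t (𝟙 v) = S.T p ∨ S.T p * S.t (𝟙 v) = 0 := by
  obtain ⟨w, v', f⟩ := p
  by_cases h : w = v
  · subst h
    exact Or.inl (S.t_mul_id f)
  · exact Or.inr (S.t_mul_t_of_ne f _ h)

theorem T_mul_T (p q : Path Λ) : S.T p * S.T q = 0 ∨ ∃ r : Path Λ, S.T p * S.T q = S.T r := by
  obtain ⟨w, v, f⟩ := p
  obtain ⟨a, w', g⟩ := q
  by_cases h : w = w'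
  · subst h
    exact Or.inr ⟨⟨a, v, g ≫ f⟩, S.ck2 _ _⟩
  · exact Or.inl (S.t_mul_t_of_ne f g h)

theorem star_T_mul_self (p : Path Λ) : star (S.T p) * S.T p = S.t (𝟙 p.1) := S.ck3 _

theorem star_T_mul_T_of_ne (hrow : IsRowFinite k Λ) {p q : Path Λ}
    (hd : deg k p.2.2 = deg k q.2.2) (h : p ≠ q) : star (S.T p) * S.T q = 0 := by
  obtain ⟨w, v, f⟩ := p
  obtain ⟨w', v', g⟩ := q
  by_cases hv : v = v'
  · subst hv
    refine S.star_t_mul_t_of_pathsTo_ne hrow (⟨w, f, hd⟩ : PathsTo k v (deg k g)) ⟨w', g, rfl⟩ ?_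
    intro he
    refine h ?_
    exact congrArg (fun r : PathsTo k v (deg k g) => (⟨r.1, v, r.2.1⟩ : Path Λ)) he
  · exact S.star_t_mul_of_ne f g hv

/-- The linear span of the elements `t_p t_q*`. -/
def spanMono : Submodule ℂ A :=
  Submodule.span ℂ (Set.range fun x : Path Λ × Path Λ => S.T x.1 * star (S.T x.2))

theorem mono_mem (p q : Path Λ) : S.T p * star (S.T q) ∈ S.spanMono :=
  Submodule.subset_span ⟨(p, q), rfl⟩

theorem T_mem (p : Path Λ) : S.T p ∈ S.spanMono := by
  have := S.mono_mem p ⟨p.1, p.1, 𝟙 _⟩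
  rwa [show S.T p * star (S.T ⟨p.1, p.1, 𝟙 _⟩) = S.T p by
    rw [T, T, S.ck1_star]; exact S.t_mul_id _] at this

/-- A path expanded by all paths of degree `n` ending at its source. -/
theorem T_eq_sum (p : Path Λ) (n : Fin k → ℕ) [Fintype (PathsTo k p.1 n)] :
    S.T p = ∑ a : PathsTo k p.1 n, S.T ⟨a.1, p.2.1, a.2.1 ≫ p.2.2⟩ * star (S.t a.2.1) := by
  conv_lhs => rw [T, ← S.t_mul_id, S.id_eq_sum p.1 n, Finset.mul_sum]
  refine Finset.sum_congr rfl fun a _ => ?_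
  rw [← mul_assoc, S.ck2, T]

/-- Extending `p` by paths of degree `d(q)` and `q` by paths of degree `d(p)` brings all paths to
degree `d(p) + d(q)`, where distinct paths have orthogonal ranges. This is what makes the span
multiplicatively closed. -/
theorem star_T_mul_T_mem (hrow : IsRowFinite k Λ) (p q : Path Λ) :
    star (S.T p) * S.T q ∈ S.spanMono := by
  have := hrow p.1 (deg k q.2.2)
  have := Fintype.ofFinite (PathsTo k p.1 (deg k q.2.2))
  have := hrow q.1 (deg k p.2.2)
  have := Fintype.ofFinite (PathsTo k q.1 (deg k p.2.2))
  rw [S.T_eq_sum p (deg k q.2.2), S.T_eq_sum q (deg k p.2.2), star_sum, Finset.sum_mul_sum]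
  refine Submodule.sum_mem _ fun a _ => Submodule.sum_mem _ fun b _ => ?_
  have hd : deg k (a.2.1 ≫ p.2.2) = deg k (b.2.1 ≫ q.2.2) := by
    simp only [deg, degree_comp, a.2.2, b.2.2]
    exact add_comm _ _
  rw [star_mul, star_star, mul_assoc, ← mul_assoc (star (S.T _))]
  by_cases h : (⟨a.1, p.2.1, a.2.1 ≫ p.2.2⟩ : Path Λ) = ⟨b.1, q.2.1, b.2.1 ≫ q.2.2⟩
  · rw [h, star_T_mul_self, ← mul_assoc]
    rcases S.T_mul_id ⟨a.1, p.1, a.2.1⟩ b.1 with h' | h'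
    · rw [show S.t a.2.1 = S.T ⟨a.1, p.1, a.2.1⟩ from rfl, h']
      exact S.mono_mem _ ⟨b.1, q.1, b.2.1⟩
    · rw [show S.t a.2.1 = S.T ⟨a.1, p.1, a.2.1⟩ from rfl, h', zero_mul]
      exact zero_mem _
  · rw [S.star_T_mul_T_of_ne hrow hd h, zero_mul, mul_zero]
    exact zero_mem _

theorem star_mem_spanMono {a : A} (ha : a ∈ S.spanMono) : star a ∈ S.spanMono := by
  induction ha using Submodule.span_induction with
  | mem x hx =>
    obtain ⟨⟨p, q⟩, rfl⟩ := hx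
    simpa using S.mono_mem q p
  | zero => simp
  | add x y _ _ h1 h2 => rw [star_add]; exact add_mem h1 h2
  | smul c x _ h => rw [star_smul]; exact Submodule.smul_mem _ _ h

theorem T_mul_mem {a : A} (ha : a ∈ S.spanMono) (p : Path Λ) : S.T p * a ∈ S.spanMono := by
  induction ha using Submodule.span_induction with
  | mem x hx =>
    obtain ⟨⟨q, r⟩, rfl⟩ := hx
    rw [← mul_assoc]
    rcases S.T_mul_T p q with h | ⟨s, h⟩
    · rw [h, zero_mul]; exact zero_mem _
    · rw [h]; exact S.mono_mem _ _
  | zero => simp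
  | add x y _ _ h1 h2 => rw [mul_add]; exact add_mem h1 h2
  | smul c x _ h => rw [mul_smul_comm]; exact Submodule.smul_mem _ _ h

theorem star_T_mul_mem (hrow : IsRowFinite k Λ) {a : A} (ha : a ∈ S.spanMono) (p : Path Λ) :
    star (S.T p) * a ∈ S.spanMono := by
  induction ha using Submodule.span_induction with
  | mem x hx =>
    obtain ⟨⟨q, r⟩, rfl⟩ := hx
    -- `t_p* t_q t_r*` is the adjoint of `t_r (t_p* t_q)*`.
    have h := S.T_mul_mem (S.star_mem_spanMono (S.star_T_mul_T_mem hrow p q)) r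
    simpa [mul_assoc] using S.star_mem_spanMono h
  | zero => simp
  | add x y _ _ h1 h2 => rw [mul_add]; exact add_mem h1 h2
  | smul c x _ h => rw [mul_smul_comm]; exact Submodule.smul_mem _ _ h

theorem mul_mem_spanMono (hrow : IsRowFinite k Λ) {a b : A} (ha : a ∈ S.spanMono)
    (hb : b ∈ S.spanMono) : a * b ∈ S.spanMono := by
  induction ha using Submodule.span_induction with
  | mem x hx =>
    obtain ⟨⟨p, q⟩, rfl⟩ := hx
    rw [mul_assoc]
    exact S.T_mul_mem (S.star_T_mul_mem hrow hb q) p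
  | zero => simp
  | add x y _ _ h1 h2 => rw [add_mul]; exact add_mem h1 h2
  | smul c x _ h => rw [smul_mul_assoc]; exact Submodule.smul_mem _ _ h

/-! ### The core -/

/-- The linear span of the elements `t_p t_q*` with `d(p) = d(q) = n`. -/
def level (n : Fin k → ℕ) : Submodule ℂ A :=
  Submodule.span ℂ ((fun x : Path Λ × Path Λ => S.T x.1 * star (S.T x.2)) ''
    {x | deg k x.1.2.2 = n ∧ deg k x.2.2.2 = n})

/-- Insert `t_w = ∑ t_a t_a*`, over the paths `a` of degree `n - m`, between `t_f` and `t_g*`. The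
levels are thus directed, and every core element lies in a single one. -/
theorem level_mono (hrow : IsRowFinite k Λ) {m n : Fin k → ℕ} (h : m ≤ n) :
    S.level m ≤ S.level n := by
  rw [level, Submodule.span_le]
  rintro _ ⟨⟨⟨w, v, f⟩, ⟨w', v', g⟩⟩, ⟨hf, hg⟩, rfl⟩
  simp only at hf hg
  by_cases hw : w = w'
  · subst hw
    have := hrow w (n - m)
    have := Fintype.ofFinite (PathsTo k w (n - m))
    have h1 : S.t f * star (S.t g) =
        ∑ a : PathsTo k w (n - m), S.t (a.2.1 ≫ f) * star (S.t (a.2.1 ≫ g)) := by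
      conv_lhs => rw [← S.t_mul_id, S.id_eq_sum w (n - m), Finset.mul_sum, Finset.sum_mul]
      refine Finset.sum_congr rfl fun a _ => ?_
      rw [← S.ck2, ← S.ck2, star_mul]
      simp only [mul_assoc]
    change S.t f * star (S.t g) ∈ S.level n
    rw [h1]
    refine Submodule.sum_mem _ fun a _ => Submodule.subset_span
      ⟨(⟨a.1, v, a.2.1 ≫ f⟩, ⟨a.1, v', a.2.1 ≫ g⟩), ?_, rfl⟩
    have ha : degree a.2.1 = n - m := a.2.2
    simp only [deg] at hf hg
    simp only [Set.mem_ofPred_eq, deg, degree_comp, hf, hg, ha, and_self]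
    exact add_tsub_cancel_of_le h
  · change S.t f * star (S.t g) ∈ S.level n
    rw [S.t_mul_star_of_ne f g hw]
    exact zero_mem _

/-- The linear span of the elements `t_p t_q*` with `d(p) = d(q)`. -/
def coreSpan : Submodule ℂ A :=
  Submodule.span ℂ ((fun x : Path Λ × Path Λ => S.T x.1 * star (S.T x.2)) ''
    {x | deg k x.1.2.2 = deg k x.2.2.2})

theorem exists_level_of_mem_coreSpan (hrow : IsRowFinite k Λ) {a : A} (ha : a ∈ S.coreSpan) :
    ∃ n, a ∈ S.level n := by
  induction ha using Submodule.span_induction with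
  | mem x hx =>
    obtain ⟨⟨p, q⟩, h, rfl⟩ := hx
    exact ⟨deg k p.2.2, Submodule.subset_span ⟨(p, q), ⟨rfl, h.symm⟩, rfl⟩⟩
  | zero => exact ⟨0, zero_mem _⟩
  | add x y _ _ h1 h2 =>
    obtain ⟨m, h1⟩ := h1
    obtain ⟨n, h2⟩ := h2
    exact ⟨m ⊔ n, add_mem (S.level_mono hrow le_sup_left h1) (S.level_mono hrow le_sup_right h2)⟩
  | smul c x _ h =>
    obtain ⟨n, h⟩ := h
    exact ⟨n, Submodule.smul_mem _ _ h⟩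

/-- The linear span of the elements `t_p t_q*` with `p, q ∈ E`. -/
def boxSpan (E : Set (Path Λ)) : Submodule ℂ A :=
  Submodule.span ℂ ((fun x : Path Λ × Path Λ => S.T x.1 * star (S.T x.2)) '' (E ×ˢ E))

theorem boxSpan_mono {E F : Set (Path Λ)} (h : E ⊆ F) : S.boxSpan E ≤ S.boxSpan F :=
  Submodule.span_mono (Set.image_mono (Set.prod_mono h h))

/-- Together with `boxAlgebra`, this places each element of a level in a finite-dimensional
*-algebra; no closure condition on `E` is needed. -/
theorem exists_finset_of_mem_level {n : Fin k → ℕ} {a : A} (ha : a ∈ S.level n) :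
    ∃ E : Finset (Path Λ), (∀ p ∈ E, deg k p.2.2 = n) ∧ a ∈ S.boxSpan (E : Set (Path Λ)) := by
  classical
  induction ha using Submodule.span_induction with
  | mem x hx =>
    obtain ⟨⟨p, q⟩, ⟨h, h'⟩, rfl⟩ := hx
    refine ⟨{p, q}, ?_, Submodule.subset_span ⟨(p, q), by simp, rfl⟩⟩
    simp only [Finset.mem_insert, Finset.mem_singleton]
    rintro r (rfl | rfl) <;> assumption
  | zero => exact ⟨∅, by simp, zero_mem _⟩
  | add x y _ _ h1 h2 =>
    obtain ⟨E, hE, h1⟩ := h1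
    obtain ⟨F, hF, h2⟩ := h2
    refine ⟨E ∪ F, fun p hp => (Finset.mem_union.1 hp).elim (hE p) (hF p),
      add_mem (S.boxSpan_mono (by simp) h1) (S.boxSpan_mono (by simp) h2)⟩
  | smul c x _ h =>
    obtain ⟨E, hE, h⟩ := h
    exact ⟨E, hE, Submodule.smul_mem _ _ h⟩

/-- The span of the `t_p t_q*` with `p, q` in a set of paths of equal degree is a *-algebra. -/
def boxAlgebra (hrow : IsRowFinite k Λ) {n : Fin k → ℕ} (E : Set (Path Λ))
    (hE : ∀ p ∈ E, deg k p.2.2 = n) : NonUnitalStarSubalgebra ℂ A where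
  __ := S.boxSpan E
  mul_mem' {a b} ha hb := by
    change a ∈ S.boxSpan E at ha
    change b ∈ S.boxSpan E at hb
    change a * b ∈ S.boxSpan E
    induction ha using Submodule.span_induction with
    | mem x hx =>
      induction hb using Submodule.span_induction with
      | mem y hy =>
        obtain ⟨⟨p, q⟩, ⟨hp, hq⟩, rfl⟩ := hx
        obtain ⟨⟨r, s⟩, ⟨hr, hs⟩, rfl⟩ := hy
        simp only
        rw [mul_assoc, ← mul_assoc (star (S.T q))]
        by_cases h : q = r
        · subst h
          rw [star_T_mul_self, ← mul_assoc]
          rcases S.T_mul_id p q.1 with h' | h'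
          · rw [h']; exact Submodule.subset_span ⟨(p, s), ⟨hp, hs⟩, rfl⟩
          · rw [h', zero_mul]; exact zero_mem _
        · rw [S.star_T_mul_T_of_ne hrow ((hE _ hq).trans (hE _ hr).symm) h]
          simp
      | zero => simp
      | add y z _ _ h1 h2 => rw [mul_add]; exact add_mem h1 h2
      | smul c y _ h => rw [mul_smul_comm]; exact Submodule.smul_mem _ _ h
    | zero => simp
    | add y z _ _ h1 h2 => rw [add_mul]; exact add_mem h1 h2
    | smul c y _ h => rw [smul_mul_assoc]; exact Submodule.smul_mem _ _ h
  star_mem' {a} ha := by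
    change a ∈ S.boxSpan E at ha
    change star a ∈ S.boxSpan E
    induction ha using Submodule.span_induction with
    | mem x hx =>
      obtain ⟨⟨p, q⟩, ⟨hp, hq⟩, rfl⟩ := hx
      exact Submodule.subset_span ⟨(q, p), ⟨hq, hp⟩, by simp⟩
    | zero => simp
    | add x y _ _ h1 h2 => rw [star_add]; exact add_mem h1 h2
    | smul c x _ h => rw [star_smul]; exact Submodule.smul_mem _ _ h

/-- The `t_p t_q*` act as matrix units: if `p` and `q` share their source, `t_p* a t_q` is the
coefficient at `(p, q)` times a vertex projection. As `φ` kills `a` but not the projection, the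
coefficient is zero. If the sources differ, `t_p t_q*` is zero itself. -/
theorem eq_zero_of_mem_boxSpan (hrow : IsRowFinite k Λ) {B : Type*} [NonUnitalCStarAlgebra B]
    (φ : A →⋆ₙₐ[ℂ] B) (hφ : ∀ v : Λ, φ (S.t (𝟙 v)) ≠ 0) {n : Fin k → ℕ} (E : Finset (Path Λ))
    (hE : ∀ p ∈ E, deg k p.2.2 = n) {a : A} (ha : a ∈ S.boxSpan (E : Set (Path Λ)))
    (h0 : φ a = 0) : a = 0 := by
  classical
  have hco : ((E : Set (Path Λ)) ×ˢ (E : Set (Path Λ))) = ((E ×ˢ E : Finset _) : Set _) := by simp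
  rw [boxSpan, hco] at ha
  obtain ⟨c, rfl⟩ := (Submodule.mem_span_image_finset_iff_exists_fun' ℂ).1 ha
  refine Finset.sum_eq_zero fun ⟨p, q⟩ hpq => ?_
  obtain ⟨hp, hq⟩ := Finset.mem_product.1 hpq
  simp only at hp hq ⊢
  by_cases hw : p.1 = q.1
  · have h1 : star (S.T p) * (∑ x ∈ E ×ˢ E, c x • (S.T x.1 * star (S.T x.2))) * S.T q =
        c (p, q) • S.t (𝟙 q.1) := by
      rw [Finset.mul_sum, Finset.sum_mul, Finset.sum_eq_single_of_mem (p, q) hpq]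
      · simp only
        rw [mul_smul_comm, smul_mul_assoc, ← mul_assoc, star_T_mul_self, mul_assoc,
          star_T_mul_self, hw, S.ck1_idem]
      · rintro ⟨r, s⟩ hrs hne
        obtain ⟨hr, hs⟩ := Finset.mem_product.1 hrs
        simp only at hr hs ⊢
        rw [mul_smul_comm, smul_mul_assoc, ← mul_assoc]
        by_cases hpr : p = r
        · have hsq : s ≠ q := fun h => hne (by rw [hpr, h])
          rw [mul_assoc, S.star_T_mul_T_of_ne hrow ((hE _ hs).trans (hE _ hq).symm) hsq]
          simp
        · rw [S.star_T_mul_T_of_ne hrow ((hE _ hp).trans (hE _ hr).symm) hpr]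
          simp
    have h2 := congrArg φ h1
    rw [map_mul, map_mul, h0, mul_zero, zero_mul, map_smul] at h2
    rw [(smul_eq_zero.1 h2.symm).resolve_right (hφ _), zero_smul]
  · rw [T, T, S.t_mul_star_of_ne _ _ hw, smul_zero]

/-- A *-homomorphism that does not kill the vertex projections is isometric on the core. -/
theorem norm_map_of_mem_coreSpan (hrow : IsRowFinite k Λ) {B : Type*} [NonUnitalCStarAlgebra B]
    (φ : A →⋆ₙₐ[ℂ] B) (hφ : ∀ v : Λ, φ (S.t (𝟙 v)) ≠ 0) {a : A} (ha : a ∈ S.coreSpan) :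
    ‖φ a‖ = ‖a‖ := by
  obtain ⟨n, ha⟩ := S.exists_level_of_mem_coreSpan hrow ha
  obtain ⟨E, hE, ha⟩ := S.exists_finset_of_mem_level ha
  refine norm_map_of_finiteDimensional φ (S.boxAlgebra hrow (E : Set (Path Λ)) hE) ?_
    (fun b hb h0 => S.eq_zero_of_mem_boxSpan hrow φ hφ E hE hb h0) ha
  exact FiniteDimensional.span_of_finite ℂ ((E.finite_toSet.prod E.finite_toSet).image _)

end CKFamily

end Families

/-! ### The gauge action, averaging, and gauge-invariant uniqueness -/

section Gauge

section TorusIntegral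

open MeasureTheory

/-- The normalised Haar measure of the torus. -/
def torusMeasure (k : ℕ) : Measure (UnitAddTorus (Fin k)) :=
  Measure.pi fun _ => AddCircle.haarAddCircle

instance (k : ℕ) : IsProbabilityMeasure (torusMeasure k) :=
  inferInstanceAs (IsProbabilityMeasure (Measure.pi fun _ => AddCircle.haarAddCircle))

instance (k : ℕ) : (torusMeasure k).IsOpenPosMeasure :=
  inferInstanceAs (Measure.IsOpenPosMeasure (Measure.pi fun _ => AddCircle.haarAddCircle))

theorem integral_mFourier {k : ℕ} (n : Fin k → ℤ) :
    ∫ z, UnitAddTorus.mFourier n z ∂torusMeasure k = if n = 0 then 1 else 0 := by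
  split_ifs with h
  · subst h
    simp [UnitAddTorus.mFourier_zero]
  · obtain ⟨i, hi⟩ := Function.ne_iff.1 h
    change ∫ z : Fin k → UnitAddCircle, ∏ i, fourier (n i) (z i)
      ∂Measure.pi (fun _ => AddCircle.haarAddCircle) = 0
    rw [integral_fintype_prod_eq_prod (f := fun i (z : UnitAddCircle) => fourier (n i) z)]
    refine Finset.prod_eq_zero (Finset.mem_univ i) ?_
    -- A nontrivial character of the circle changes sign under translation by half its period.
    exact integral_eq_zero_of_add_right_eq_neg (μ := AddCircle.haarAddCircle)
      (fourier_add_half_inv_index hi one_pos)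

theorem continuous_torus_integrable {k : ℕ} {E : Type*} [NormedAddCommGroup E]
    {f : UnitAddTorus (Fin k) → E} (hf : Continuous f) : Integrable f (torusMeasure k) :=
  hf.integrable_of_hasCompactSupport (HasCompactSupport.of_compactSpace f)

theorem norm_mFourier_apply {k : ℕ} (n : Fin k → ℤ) (z : UnitAddTorus (Fin k)) :
    ‖UnitAddTorus.mFourier n z‖ = 1 := by
  simp only [UnitAddTorus.mFourier, fourier_apply, ContinuousMap.coe_mk, norm_prod,
    Circle.norm_coe, Finset.prod_const_one]

theorem star_mFourier_mul {k : ℕ} (n : Fin k → ℤ) (z : UnitAddTorus (Fin k)) :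
    star (UnitAddTorus.mFourier n z) * UnitAddTorus.mFourier n z = 1 := by
  rw [Complex.star_def, ← Complex.normSq_eq_conj_mul_self, Complex.normSq_eq_norm_sq,
    norm_mFourier_apply]
  simp

theorem mFourier_mul_star {k : ℕ} (n : Fin k → ℤ) (z : UnitAddTorus (Fin k)) :
    UnitAddTorus.mFourier n z * star (UnitAddTorus.mFourier n z) = 1 := by
  rw [mul_comm, star_mFourier_mul]

/-- A continuous function on the torus with non-negative values in a C*-algebra vanishes at
zero if its integral vanishes. -/
theorem eq_zero_of_integral_star_mul_self_eq_zero {k : ℕ} {A : Type*} [NonUnitalCStarAlgebra A]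
    {f : UnitAddTorus (Fin k) → A} (hf : Continuous f)
    (h : ∫ z, star (f z) * f z ∂torusMeasure k = 0) : f 0 = 0 := by
  let _ := CStarAlgebra.spectralOrder A
  have _ := CStarAlgebra.spectralOrderedRing A
  rw [← CStarRing.star_mul_self_eq_zero_iff, ← norm_le_zero_iff]
  set g : UnitAddTorus (Fin k) → A := fun z => star (f z) * f z with hg
  have hgc : Continuous g := hf.star.mul hf
  have hg0 : 0 ≤ g := fun z => star_mul_self_nonneg (f z)
  change ‖g 0‖ ≤ 0
  refine le_of_forall_pos_le_add fun ε hε => ?_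
  rw [zero_add]
  -- On `U` the function `g` stays within `ε` of `g 0`, while its integral over `U` is squeezed to
  -- zero by positivity. So the measure of `U` times `‖g 0‖` is at most `ε` times that measure.
  obtain ⟨U, hU, hUo, h0U⟩ := mem_nhds_iff.1
    (Metric.continuousAt_iff'.1 (hgc.continuousAt (x := 0)) ε hε)
  have hUint : ∫ z in U, g z ∂torusMeasure k = 0 := by
    refine le_antisymm ?_ (integral_nonneg hg0)
    rw [← h]
    exact setIntegral_le_integral (continuous_torus_integrable hgc)
      (Filter.Eventually.of_forall hg0)
  have hpos : 0 < (torusMeasure k).real U :=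
    ENNReal.toReal_pos (hUo.measure_pos _ ⟨0, h0U⟩).ne' (measure_ne_top _ _)
  have h1 : ∫ z in U, (g z - g 0) ∂torusMeasure k = -((torusMeasure k).real U • g 0) := by
    rw [integral_sub (continuous_torus_integrable hgc).integrableOn
      (integrable_const _), hUint, setIntegral_const, zero_sub]
  have h2 : ‖∫ z in U, (g z - g 0) ∂torusMeasure k‖ ≤ ε * (torusMeasure k).real U :=
    norm_setIntegral_le_of_norm_le_const (measure_lt_top _ _) fun z hz => by
      rw [← dist_eq_norm]; exact (hU hz).le
  rw [h1, norm_neg, norm_smul, Real.norm_of_nonneg hpos.le, mul_comm] at h2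
  exact le_of_mul_le_mul_right h2 hpos

end TorusIntegral

variable {k : ℕ} {Λ : Type u} [SmallCategory Λ] [HigherRankGraph k Λ]

/-- The degree as an element of `ℤ^k`. -/
def zdeg (k : ℕ) {Λ : Type u} [SmallCategory Λ] [HigherRankGraph k Λ] {w v : Λ} (f : w ⟶ v) :
    Fin k → ℤ := fun i => deg k f i

theorem zdeg_id (v : Λ) : zdeg k (𝟙 v) = 0 := by
  funext i
  simp [zdeg, deg, degree_id]

theorem zdeg_comp {a w v : Λ} (g : a ⟶ w) (f : w ⟶ v) :
    zdeg k (g ≫ f) = zdeg k f + zdeg k g := by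
  funext i
  simp [zdeg, deg, degree_comp]

theorem zdeg_inj {w v w' v' : Λ} {f : w ⟶ v} {g : w' ⟶ v'} :
    zdeg k f = zdeg k g ↔ deg k f = deg k g := by
  simp [zdeg, funext_iff]

open UnitAddTorus in
/-- A Cuntz-Krieger family multiplied by a character of the degree. -/
def CKFamily.twist {A : Type*} [NonUnitalCStarAlgebra A] (S : CKFamily k Λ A)
    (z : UnitAddTorus (Fin k)) : CKFamily k Λ A where
  t f := mFourier (zdeg k f) z • S.t f
  partialIsometry f := by
    rw [star_smul, smul_mul_smul_comm, smul_mul_smul_comm, S.partialIsometry, mFourier_mul_star,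
      one_mul]
  ck1_star v := by simp [zdeg_id, mFourier_zero, S.ck1_star]
  ck1_idem v := by simp [zdeg_id, mFourier_zero, S.ck1_idem]
  ck1_orth v w h := by simp [zdeg_id, mFourier_zero, S.ck1_orth _ _ h]
  ck2 g f := by rw [smul_mul_smul_comm, S.ck2, zdeg_comp, mFourier_add]
  ck3 f := by
    rw [star_smul, smul_mul_smul_comm, star_mFourier_mul, S.ck3, zdeg_id, mFourier_zero]
    simp
  ck4 v n := by
    simp only [zdeg_id, mFourier_zero, star_smul, smul_mul_smul_comm, mFourier_mul_star,
      ContinuousMap.one_apply, one_smul]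
    exact S.ck4 v n

/-- The pair with the twisted family. -/
def CKPair.twist (S : CKPair k Λ) (z : UnitAddTorus (Fin k)) : CKPair k Λ :=
  ⟨S.A, S.fam.twist z⟩

variable (k Λ) in
/-- The gauge automorphism of the product of all Cuntz-Krieger families: it permutes the
coordinates. -/
def prodGauge (z : UnitAddTorus (Fin k)) : CKProduct k Λ →⋆ₙₐ[ℂ] CKProduct k Λ where
  toFun a := ⟨fun S => (a (S.twist z) : S.A), by
    obtain ⟨C, hC⟩ := memℓp_infty_iff.1 (lp.memℓp a)
    refine memℓp_infty ⟨C, ?_⟩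
    rintro _ ⟨S, rfl⟩
    exact hC ⟨S.twist z, rfl⟩⟩
  map_smul' _ _ := rfl
  map_zero' := rfl
  map_add' _ _ := rfl
  map_mul' _ _ := rfl
  map_star' _ := rfl

theorem continuous_starHom {A B : Type*} [NonUnitalCStarAlgebra A] [NonUnitalCStarAlgebra B]
    (φ : A →⋆ₙₐ[ℂ] B) : Continuous φ :=
  AddMonoidHomClass.continuous_of_bound φ 1 fun x => by
    simpa using NonUnitalStarAlgHom.norm_apply_le φ x

open UnitAddTorus in
theorem prodGauge_prodGen (z : UnitAddTorus (Fin k)) {w v : Λ} (f : w ⟶ v) :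
    prodGauge k Λ z (prodGen k f) = mFourier (zdeg k f) z • prodGen k f := rfl

theorem prodGauge_mem (z : UnitAddTorus (Fin k)) {a : CKProduct k Λ}
    (ha : a ∈ cstarSubalgebra k Λ) : prodGauge k Λ z a ∈ cstarSubalgebra k Λ := by
  have h : cstarSubalgebra k Λ ≤ (cstarSubalgebra k Λ).comap (prodGauge k Λ z) := by
    refine NonUnitalStarSubalgebra.topologicalClosure_minimal _
      (NonUnitalStarAlgebra.adjoin_le ?_) ?_
    · rintro _ ⟨w, v, f, rfl⟩
      change prodGauge k Λ z (prodGen k f) ∈ cstarSubalgebra k Λ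
      rw [prodGauge_prodGen]
      exact SMulMemClass.smul_mem _ (gen k f).2
    · exact (NonUnitalStarSubalgebra.isClosed_topologicalClosure _).preimage
        (continuous_starHom (prodGauge k Λ z))
  exact h ha

variable (k Λ) in
/-- The gauge action of the torus on `C*(Λ)`. -/
def gauge (z : UnitAddTorus (Fin k)) : CStar k Λ →⋆ₙₐ[ℂ] CStar k Λ where
  toFun a := ⟨prodGauge k Λ z a, prodGauge_mem z a.2⟩
  map_smul' _ _ := rfl
  map_zero' := rfl
  map_add' _ _ := rfl
  map_mul' _ _ := rfl
  map_star' _ := rfl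

open UnitAddTorus in
theorem gauge_gen (z : UnitAddTorus (Fin k)) {w v : Λ} (f : w ⟶ v) :
    gauge k Λ z (gen k f) = mFourier (zdeg k f) z • gen k f := rfl

theorem norm_gauge_le (z : UnitAddTorus (Fin k)) (a : CStar k Λ) : ‖gauge k Λ z a‖ ≤ ‖a‖ :=
  NonUnitalStarAlgHom.norm_apply_le (gauge k Λ z) a

section Density

/-- The linear span of the `t_p t_q*` is dense in `C*(Λ)`. -/
theorem dense_spanMono (hrow : IsRowFinite k Λ) :
    Dense ((universalFamily k Λ hrow).spanMono : Set (CStar k Λ)) := by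
  set S := universalFamily k Λ hrow
  rintro ⟨a, ha⟩
  rw [closure_subtype]
  refine closure_mono ?_ ha
  intro b hb
  suffices h : ∃ hb : b ∈ cstarSubalgebra k Λ, (⟨b, hb⟩ : CStar k Λ) ∈ S.spanMono from
    ⟨⟨b, h.1⟩, h.2, rfl⟩
  induction hb using NonUnitalStarAlgebra.adjoin_induction with
  | mem x hx =>
    obtain ⟨w, v, f, rfl⟩ := hx
    exact ⟨(gen k f).2, S.T_mem ⟨w, v, f⟩⟩
  | add x y _ _ h1 h2 => exact ⟨_, add_mem h1.2 h2.2⟩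
  | zero => exact ⟨zero_mem _, zero_mem S.spanMono⟩
  | mul x y _ _ h1 h2 => exact ⟨_, S.mul_mem_spanMono hrow h1.2 h2.2⟩
  | smul r x _ h1 => exact ⟨_, S.spanMono.smul_mem r h1.2⟩
  | star x _ h1 => exact ⟨_, S.star_mem_spanMono h1.2⟩

/-- Density of the span of the `t_p t_q*` reduces closed linear properties to these monomials, on
which the gauge action is scalar multiplication by a character. -/
theorem CStar.induction_on (hrow : IsRowFinite k Λ) {P : CStar k Λ → Prop} (hcl : IsClosed {a | P a})
    (hmono : ∀ p q : Path Λ, P (gen k p.2.2 * star (gen k q.2.2))) (hzero : P 0)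
    (hadd : ∀ a b, P a → P b → P (a + b)) (hsmul : ∀ (c : ℂ) a, P a → P (c • a))
    (a : CStar k Λ) : P a := by
  have h : ((universalFamily k Λ hrow).spanMono : Set (CStar k Λ)) ⊆ {a | P a} := by
    intro b hb
    induction hb using Submodule.span_induction with
    | mem x hx =>
      obtain ⟨⟨p, q⟩, rfl⟩ := hx
      exact hmono p q
    | zero => exact hzero
    | add x y _ _ h1 h2 => exact hadd x y h1 h2
    | smul c x _ h => exact hsmul c x h
  exact closure_minimal h hcl (dense_spanMono hrow a)

open UnitAddTorus in
theorem gauge_mono (z : UnitAddTorus (Fin k)) (p q : Path Λ) :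
    gauge k Λ z (gen k p.2.2 * star (gen k q.2.2)) =
      mFourier (zdeg k p.2.2 - zdeg k q.2.2) z • (gen k p.2.2 * star (gen k q.2.2)) := by
  rw [map_mul, map_star, gauge_gen, gauge_gen, star_smul, smul_mul_smul_comm, sub_eq_add_neg,
    mFourier_add, mFourier_neg, Complex.star_def]

theorem gauge_zero (hrow : IsRowFinite k Λ) (a : CStar k Λ) : gauge k Λ 0 a = a := by
  induction a using CStar.induction_on hrow with
  | hcl => exact isClosed_eq (continuous_starHom _) continuous_id
  | hmono p q => rw [gauge_mono]; simp [UnitAddTorus.mFourier]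
  | hzero => exact map_zero _
  | hadd a b ha hb => rw [map_add, ha, hb]
  | hsmul c a ha => rw [map_smul, ha]

theorem continuous_gauge (hrow : IsRowFinite k Λ) (a : CStar k Λ) :
    Continuous fun z => gauge k Λ z a := by
  induction a using CStar.induction_on hrow with
  | hcl =>
    refine isClosed_of_closure_subset fun a ha => ?_
    rw [Metric.mem_closure_iff] at ha
    -- The approximation is uniform in `z` because every gauge map is contractive.
    refine continuous_of_uniform_approx_of_continuous fun u hu => ?_
    obtain ⟨ε, hε, hεu⟩ := Metric.mem_uniformity_dist.1 hu
    obtain ⟨b, hb, hab⟩ := ha ε hε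
    refine ⟨fun z => gauge k Λ z b, hb, fun z => hεu ?_⟩
    rw [dist_eq_norm, ← map_sub]
    rw [dist_eq_norm] at hab
    exact (norm_gauge_le z _).trans_lt hab
  | hmono p q =>
    simp only [gauge_mono]
    exact (UnitAddTorus.mFourier _).continuous.smul continuous_const
  | hzero => simp only [map_zero]; exact continuous_const
  | hadd a b ha hb => simp only [map_add]; exact ha.add hb
  | hsmul c a ha => simp only [map_smul]; exact ha.const_smul c

/-- Averaging over the gauge action, as a bounded linear map. -/
def gaugeMean (hrow : IsRowFinite k Λ) : CStar k Λ →L[ℂ] CStar k Λ :=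
  LinearMap.mkContinuous
    { toFun := fun a => ∫ z, gauge k Λ z a ∂torusMeasure k
      map_add' := fun a b => by
        simp only [map_add]
        exact MeasureTheory.integral_add (continuous_torus_integrable (continuous_gauge hrow a))
          (continuous_torus_integrable (continuous_gauge hrow b))
      map_smul' := fun c a => by
        simp only [map_smul, RingHom.id_apply]
        exact MeasureTheory.integral_smul c _ } 1 fun a => by
    simpa using MeasureTheory.norm_integral_le_of_norm_le_const (μ := torusMeasure k)
      (Filter.Eventually.of_forall fun z => norm_gauge_le z a)

theorem gaugeMean_apply (hrow : IsRowFinite k Λ) (a : CStar k Λ) :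
    gaugeMean hrow a = ∫ z, gauge k Λ z a ∂torusMeasure k := rfl

/-- What is integrated is the character of index `d(p) - d(q)`, whose mean is zero unless it is
trivial. -/
theorem gaugeMean_mono (hrow : IsRowFinite k Λ) (p q : Path Λ) :
    gaugeMean hrow (gen k p.2.2 * star (gen k q.2.2)) =
      if deg k p.2.2 = deg k q.2.2 then gen k p.2.2 * star (gen k q.2.2) else 0 := by
  rw [gaugeMean_apply]
  simp only [gauge_mono]
  rw [integral_smul_const, integral_mFourier]
  simp only [sub_eq_zero, zdeg_inj]
  split_ifs <;> simp

theorem gaugeMean_mem_core (hrow : IsRowFinite k Λ) (a : CStar k Λ) :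
    gaugeMean hrow a ∈ (universalFamily k Λ hrow).coreSpan.topologicalClosure := by
  set S := universalFamily k Λ hrow
  induction a using CStar.induction_on hrow with
  | hcl =>
    exact S.coreSpan.isClosed_topologicalClosure.preimage (gaugeMean hrow).continuous
  | hmono p q =>
    rw [gaugeMean_mono]
    split_ifs with h
    · exact S.coreSpan.le_topologicalClosure (Submodule.subset_span ⟨(p, q), h, rfl⟩)
    · exact zero_mem _
  | hzero => rw [map_zero]; exact zero_mem _
  | hadd a b ha hb => rw [map_add]; exact add_mem ha hb
  | hsmul c a ha => rw [map_smul]; exact Submodule.smul_mem _ c ha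

/-- The integrand `γ_z(a)* γ_z(a)` is continuous and positive with zero integral, so it vanishes at
the identity of the torus, where `γ_z(a) = a`. -/
theorem eq_zero_of_gaugeMean_eq_zero (hrow : IsRowFinite k Λ) {a : CStar k Λ}
    (h : gaugeMean hrow (star a * a) = 0) : a = 0 := by
  rw [← gauge_zero hrow a]
  refine eq_zero_of_integral_star_mul_self_eq_zero (f := fun z => gauge k Λ z a)
    (continuous_gauge hrow a) ?_
  rw [gaugeMean_apply] at h
  simpa only [map_mul, map_star] using h

/-- The gauge-invariant uniqueness theorem: a *-homomorphism on `C*(Λ)` that does not kill a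
vertex projection and whose kernel is invariant under averaging is injective. -/
theorem injective_of_gaugeMean (hrow : IsRowFinite k Λ) {B : Type*} [NonUnitalCStarAlgebra B]
    (φ : CStar k Λ →⋆ₙₐ[ℂ] B) (hφ : ∀ v : Λ, φ (gen k (𝟙 v)) ≠ 0)
    (hker : ∀ a, φ a = 0 → φ (gaugeMean hrow a) = 0) : Function.Injective φ := by
  refine (injective_iff_map_eq_zero φ).2 fun a ha => ?_
  refine eq_zero_of_gaugeMean_eq_zero hrow ?_
  have h0 : φ (gaugeMean hrow (star a * a)) = 0 := hker _ (by rw [map_mul, ha, mul_zero])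
  -- Isometry, unlike injectivity, passes from the algebraic core to its closure.
  have hiso : ∀ b ∈ (universalFamily k Λ hrow).coreSpan.topologicalClosure, ‖φ b‖ = ‖b‖ := by
    intro b hb
    have hcl : IsClosed {b : CStar k Λ | ‖φ b‖ = ‖b‖} :=
      isClosed_eq (continuous_starHom φ).norm continuous_norm
    exact closure_minimal (fun c hc =>
      (universalFamily k Λ hrow).norm_map_of_mem_coreSpan hrow φ hφ hc) hcl hb
  have := hiso _ (gaugeMean_mem_core hrow (star a * a))
  rwa [h0, norm_zero, eq_comm, norm_eq_zero] at this

end Density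

end Gauge

/-! ### Partial bijections of the basis and the path representations -/

section PathRepresentations

section PartialEquivOperators

open Classical in
/-- A functional and injective relation as a partial equivalence. -/
def pequivOfRel {α β : Type*} (R : α → β → Prop) (hf : ∀ a b b', R a b → R a b' → b = b')
    (hi : ∀ a a' b, R a b → R a' b → a = a') : α ≃. β where
  toFun a := if h : ∃ b, R a b then some h.choose else none
  invFun b := if h : ∃ a, R a b then some h.choose else none
  inv a b := by
    simp only [Option.dite_none_right_eq_some, Option.some.injEq]
    constructor
    · rintro ⟨h, rfl⟩
      have h' : ∃ b, R h.choose b := ⟨_, h.choose_spec⟩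
      exact ⟨h', hf _ _ _ h'.choose_spec h.choose_spec⟩
    · rintro ⟨h, rfl⟩
      have h' : ∃ a, R a h.choose := ⟨_, h.choose_spec⟩
      exact ⟨h', hi _ _ _ h'.choose_spec h.choose_spec⟩

theorem mem_pequivOfRel {α β : Type*} {R : α → β → Prop}
    {hf : ∀ a b b', R a b → R a b' → b = b'} {hi : ∀ a a' b, R a b → R a' b → a = a'}
    {a : α} {b : β} : b ∈ pequivOfRel R hf hi a ↔ R a b := by
  classical
  change b ∈ (if h : ∃ b, R a b then some h.choose else none) ↔ _
  simp only [Option.mem_def, Option.dite_none_right_eq_some, Option.some.injEq]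
  constructor
  · rintro ⟨h, rfl⟩
    exact h.choose_spec
  · intro h
    have h' : ∃ b, R a b := ⟨b, h⟩
    exact ⟨h', hf _ _ _ h'.choose_spec h⟩

variable {α : Type u}

/-- The possibly nonzero terms are the `h b` with `b` in the preimage of `s`, each occurring once.
The bound gives both square-summability and contractivity of `pequivOp`. -/
theorem sum_pequiv_le (e : α ≃. α) (h : lp (fun _ : α => ℂ) 2) (s : Finset α) :
    ∑ c ∈ s, ‖(e.symm c).elim 0 h‖ ^ (2 : ℝ≥0∞).toReal ≤ ‖h‖ ^ (2 : ℝ≥0∞).toReal := by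
  classical
  have h2 : (0 : ℝ) < (2 : ℝ≥0∞).toReal := by norm_num
  have key : ∑ c ∈ s, ‖(e.symm c).elim 0 h‖ ^ (2 : ℝ≥0∞).toReal =
      ∑ b ∈ s.filterMap e.symm (fun _ _ _ => e.symm.inj), ‖h b‖ ^ (2 : ℝ≥0∞).toReal := by
    symm
    -- The default `b` is never taken: `e` is defined at every index of this sum.
    refine Finset.sum_of_injOn (fun b => (e b).getD b) ?_ ?_ ?_ ?_
    · intro b hb b' hb' hbb
      simp only [Finset.coe_filterMap, Set.mem_ofPred_eq] at hb hb'
      obtain ⟨c, -, hc⟩ := hb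
      obtain ⟨c', -, hc'⟩ := hb'
      have h1 := e.mem_iff_mem.1 hc
      have h1' := e.mem_iff_mem.1 hc'
      simp only [Option.mem_def] at h1 h1'
      simp only [h1, h1', Option.getD_some] at hbb
      subst hbb
      exact e.inj h1 h1'
    · intro b hb
      simp only [Finset.coe_filterMap, Set.mem_ofPred_eq] at hb
      obtain ⟨c, hcs, hc⟩ := hb
      have h1 := e.mem_iff_mem.1 hc
      simp only [Option.mem_def] at h1
      simpa [h1] using hcs
    · intro c hc hn
      cases hb : e.symm c with
      | none => simp
      | some b =>
        refine absurd ⟨b, ?_, ?_⟩ hn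
        · simp only [Finset.coe_filterMap, Set.mem_ofPred_eq]
          exact ⟨c, hc, hb⟩
        · simp [e.eq_some_iff.1 hb]
    · intro b hb
      obtain ⟨c, -, hc⟩ := (Finset.mem_filterMap _).1 hb
      have h1 := e.eq_some_iff.1 hc
      simp [h1, hc]
  rw [key]
  exact lp.sum_rpow_le_norm_rpow h2 h _

/-- The operator on `ℓ²(α)` that moves the standard basis by a partial equivalence of `α`. -/
def pequivOp (e : α ≃. α) : lp (fun _ : α => ℂ) 2 →L[ℂ] lp (fun _ : α => ℂ) 2 :=
  LinearMap.mkContinuous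
    { toFun := fun h => ⟨fun c => (e.symm c).elim 0 h, memℓp_gen' (sum_pequiv_le e h)⟩
      map_add' := fun g h => lp.ext (funext fun c => by
        have key : ∀ o : Option α, (o.elim 0 fun b => g b + h b) = o.elim 0 g + o.elim 0 h := by
          rintro (_ | b) <;> simp
        exact key _)
      map_smul' := fun a h => lp.ext (funext fun c => by
        have key : ∀ o : Option α, (o.elim 0 fun b => a • h b) = a • (o.elim 0 h : ℂ) := by
          rintro (_ | b) <;> simp
        exact key _) } 1 fun h => by
    rw [one_mul]
    exact lp.norm_le_of_forall_sum_le (by norm_num) (norm_nonneg h) (sum_pequiv_le e h)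

theorem pequivOp_apply (e : α ≃. α) (h : lp (fun _ : α => ℂ) 2) (c : α) :
    pequivOp e h c = (e.symm c).elim 0 h := rfl

theorem pequivOp_trans (e f : α ≃. α) : pequivOp (e.trans f) = pequivOp f * pequivOp e := by
  ext h c
  change ((e.trans f).symm c).elim 0 h = (f.symm c).elim 0 fun b => (e.symm b).elim 0 h
  rw [PEquiv.symm_trans_rev]
  change ((f.symm c).bind e.symm).elim 0 h = _
  cases f.symm c <;> rfl

theorem pequivOp_bot : pequivOp (⊥ : α ≃. α) = 0 := by
  ext h c
  rfl

/-- Both inner products are sums over the graph of `e`, indexed by the domain on one side and by the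
range on the other; `i` below is `e` on the support. -/
theorem star_pequivOp (e : α ≃. α) : star (pequivOp e) = pequivOp e.symm := by
  rw [ContinuousLinearMap.star_eq_adjoint, eq_comm, ContinuousLinearMap.eq_adjoint_iff]
  intro g h
  rw [lp.inner_eq_tsum, lp.inner_eq_tsum]
  have hne : ∀ {e : α ≃. α} {g : α → ℂ} {c : α}, (e c).elim 0 g ≠ 0 → ∃ b, e c = some b := by
    intro e g c h
    cases hc : e c with
    | none => simp [hc] at h
    | some b => exact ⟨b, rfl⟩
  have hL : ∀ c : Function.support fun c => inner ℂ (pequivOp e.symm g c) (h c),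
      ∃ b, e c = some b := by
    rintro ⟨c, hc⟩
    refine hne (e := e) (g := g) fun h0 => hc ?_
    simp [pequivOp_apply, h0]
  choose i hi using hL
  symm
  refine tsum_eq_tsum_of_ne_zero_bij i ?_ ?_ ?_
  · intro c c' hcc
    exact Subtype.ext (e.inj (hi c) (by rw [hcc]; exact hi c'))
  · intro b hb
    obtain ⟨c, hc⟩ := hne (e := e.symm) (g := h) (c := b) fun h0 => hb (by
      simp [pequivOp_apply, h0])
    have hc' := e.eq_some_iff.1 hc
    have hmem : c ∈ Function.support fun c => inner ℂ (pequivOp e.symm g c) (h c) := by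
      simp only [Function.mem_support, pequivOp_apply, hc, PEquiv.symm_symm, hc'] at hb ⊢
      simpa using hb
    refine ⟨⟨c, hmem⟩, ?_⟩
    have := hi ⟨c, hmem⟩
    simp only [hc', Option.some.injEq] at this
    exact this.symm
  · intro c
    simp only [pequivOp_apply, PEquiv.symm_symm, hi c, e.eq_some_iff.2 (hi c), Option.elim]

open InfinitePath in
theorem basisVec_apply_self (a : α) : basisVec a a = 1 := by
  classical
  rw [basisVec, lp.single_apply_self]

open InfinitePath in
theorem pequivOp_basisVec (e : α ≃. α) (a : α) :
    pequivOp e (basisVec a) = (e a).elim 0 basisVec := by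
  classical
  ext c
  rw [pequivOp_apply]
  cases hc : e.symm c with
  | none =>
    cases ha : e a with
    | none => rfl
    | some b =>
      have : c ≠ b := by
        rintro rfl
        rw [e.eq_some_iff.2 ha] at hc
        cases hc
      simp [basisVec, lp.single_apply, this]
  | some b =>
    have hb := e.eq_some_iff.1 hc
    by_cases hab : b = a
    · subst hab
      simp [hb, basisVec]
    · cases ha : e a with
      | none => simp [basisVec, lp.single_apply, hab]
      | some c' =>
        have : c ≠ c' := by
          rintro rfl
          exact hab (e.inj hb ha)
        simp [basisVec, lp.single_apply, hab, this]

end PartialEquivOperators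

namespace InfinitePath

variable {k : ℕ} {Λ : Type u} [SmallCategory Λ] [HigherRankGraph k Λ] (x : InfinitePath k Λ)

/-- The class of a path in `F_i`. -/
def cls (i : ℕ) {v : Λ} (μ : x.vertex i ⟶ v) : x.GenClass :=
  Quotient.mk x.genSetoid ⟨i, ⟨v, μ⟩⟩

theorem exists_cls (c : x.GenClass) : ∃ (i : ℕ) (v : Λ) (μ : x.vertex i ⟶ v), c = x.cls i μ := by
  obtain ⟨⟨i, v, μ⟩, rfl⟩ := Quotient.exists_rep c
  exact ⟨i, v, μ, rfl⟩

theorem cls_eq_iff {i j : ℕ} {v : Λ} (μ : x.vertex i ⟶ v) (ν : x.vertex j ⟶ v) :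
    x.cls i μ = x.cls j ν ↔ ∃ (l : ℕ) (hi : i ≤ l) (hj : j ≤ l), x.seg hi ≫ μ = x.seg hj ≫ ν := by
  rw [cls, cls, Quotient.eq]
  change x.Rel _ _ ↔ _
  rw [rel_iff]
  simp only [extend, Sigma.mk.injEq, heq_eq_eq, true_and]

theorem range_eq_of_cls_eq {i j : ℕ} {v w : Λ} {μ : x.vertex i ⟶ v} {ν : x.vertex j ⟶ w}
    (h : x.cls i μ = x.cls j ν) : v = w := by
  rw [cls, cls, Quotient.eq] at h
  change x.Rel _ _ at h
  rw [rel_iff] at h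
  obtain ⟨l, hi, hj, h⟩ := h
  exact congrArg Sigma.fst h

theorem cls_extend {i j : ℕ} (h : i ≤ j) {v : Λ} (μ : x.vertex i ⟶ v) :
    x.cls j (x.seg h ≫ μ) = x.cls i μ :=
  Quotient.sound (Or.inr ⟨h, rfl⟩)

/-- The relation `[μ] ↦ [f μ]`. -/
def shiftRel {w v : Λ} (f : w ⟶ v) (c c' : x.GenClass) : Prop :=
  ∃ (i : ℕ) (μ : x.vertex i ⟶ w), c = x.cls i μ ∧ c' = x.cls i (μ ≫ f)

/-- The partial bijection `[μ] ↦ [f μ]`. -/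
def shift {w v : Λ} (f : w ⟶ v) : x.GenClass ≃. x.GenClass :=
  pequivOfRel (x.shiftRel f)
    (by
      rintro _ _ _ ⟨i, μ, rfl, rfl⟩ ⟨j, ν, h, rfl⟩
      obtain ⟨l, hi, hj, h⟩ := (x.cls_eq_iff _ _).1 h
      refine (x.cls_eq_iff _ _).2 ⟨l, hi, hj, ?_⟩
      rw [← Category.assoc, h, Category.assoc])
    -- Injectivity is the cancellation of `f`.
    (by
      rintro _ _ _ ⟨i, μ, rfl, rfl⟩ ⟨j, ν, rfl, h⟩
      obtain ⟨l, hi, hj, h⟩ := (x.cls_eq_iff _ _).1 h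
      refine (x.cls_eq_iff _ _).2 ⟨l, hi, hj, ?_⟩
      rw [← Category.assoc, ← Category.assoc] at h
      exact comp_right_cancel k h)

theorem mem_shift {w v : Λ} {f : w ⟶ v} {c c' : x.GenClass} :
    c' ∈ x.shift f c ↔ ∃ (i : ℕ) (μ : x.vertex i ⟶ w), c = x.cls i μ ∧ c' = x.cls i (μ ≫ f) :=
  mem_pequivOfRel

theorem shift_cls {w v : Λ} (f : w ⟶ v) {i : ℕ} (μ : x.vertex i ⟶ w) :
    x.shift f (x.cls i μ) = some (x.cls i (μ ≫ f)) :=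
  x.mem_shift.2 ⟨i, μ, rfl, rfl⟩

theorem shift_cls_of_ne {w v a : Λ} (f : w ⟶ v) {i : ℕ} (μ : x.vertex i ⟶ a) (h : w ≠ a) :
    x.shift f (x.cls i μ) = none := by
  refine Option.eq_none_iff_forall_not_mem.2 fun c hc => ?_
  obtain ⟨j, ν, h1, -⟩ := x.mem_shift.1 hc
  exact h (x.range_eq_of_cls_eq h1).symm

theorem shift_comp {a w v : Λ} (g : a ⟶ w) (f : w ⟶ v) :
    x.shift (g ≫ f) = (x.shift g).trans (x.shift f) := by
  refine PEquiv.ext fun c => ?_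
  obtain ⟨i, b, μ, rfl⟩ := x.exists_cls c
  change _ = (x.shift g (x.cls i μ)).bind (x.shift f)
  by_cases h : a = b
  · subst h
    rw [shift_cls, shift_cls, Option.bind_some, shift_cls, Category.assoc]
  · rw [shift_cls_of_ne _ _ _ h, shift_cls_of_ne _ _ _ h, Option.bind_none]

/-- The domain of `shift f` consists of all classes with range `w`; this gives `ck3`. -/
theorem shift_trans_symm {w v : Λ} (f : w ⟶ v) :
    (x.shift f).trans (x.shift f).symm = x.shift (𝟙 w) := by
  refine PEquiv.ext fun c => ?_
  obtain ⟨i, b, μ, rfl⟩ := x.exists_cls c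
  change (x.shift f (x.cls i μ)).bind (x.shift f).symm = _
  by_cases h : w = b
  · subst h
    rw [shift_cls, shift_cls, Option.bind_some, Category.comp_id, PEquiv.eq_some_iff, shift_cls]
  · rw [shift_cls_of_ne _ _ _ h, shift_cls_of_ne _ _ _ h, Option.bind_none]

theorem shift_id_symm (v : Λ) : (x.shift (𝟙 v)).symm = x.shift (𝟙 v) := by
  rw [← x.shift_trans_symm (𝟙 v), PEquiv.symm_trans_rev, PEquiv.symm_symm]

theorem deg_seg {i j : ℕ} (h : i ≤ j) : deg k (x.seg h) = fun _ => j - i :=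
  x.degree_map _

/-- Every class with range `v` extends a path of degree `n` with range `v`. -/
theorem exists_pathsTo_of_cls {i : ℕ} {v : Λ} (μ : x.vertex i ⟶ v) (n : Fin k → ℕ) :
    ∃ (p : PathsTo k v n) (j : ℕ) (ν : x.vertex j ⟶ p.1), x.cls i μ = x.cls j (ν ≫ p.2.1) := by
  -- The representative `μ` may be too short to contain a factor of degree `n`; following `x` for `∑
  -- l, n l` further diagonal steps makes it long enough.
  have hij : i ≤ i + ∑ l, n l := Nat.le_add_right _ _
  obtain ⟨a, p, g, h1, h2, -⟩ := exists_factor (k := k) (x.seg hij ≫ μ) (n := n) (by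
    simp only [deg, degree_comp]
    have h : degree (x.seg hij) = _ := x.deg_seg hij
    rw [h]
    intro l
    have := Finset.single_le_sum (f := n) (fun _ _ => Nat.zero_le _) (Finset.mem_univ l)
    simp only [Pi.add_apply]
    omega)
  exact ⟨⟨a, p, h2⟩, _, g, by rw [h1, cls_extend]⟩

/-- The paths of degree `n` with range `v` have disjoint sets of extensions. -/
theorem pathsTo_eq_of_cls_eq {v : Λ} {n : Fin k → ℕ} {p q : PathsTo k v n} {i j : ℕ}
    {μ : x.vertex i ⟶ p.1} {ν : x.vertex j ⟶ q.1}
    (h : x.cls i (μ ≫ p.2.1) = x.cls j (ν ≫ q.2.1)) : p = q := by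
  obtain ⟨l, hi, hj, h⟩ := (x.cls_eq_iff _ _).1 h
  rw [← Category.assoc, ← Category.assoc] at h
  have := sigma_eq_of_comp_eq k h (p.2.2.trans q.2.2.symm)
  obtain ⟨w, f, hf⟩ := p
  obtain ⟨w', g, hg⟩ := q
  obtain rfl : w = w' := congrArg Sigma.fst this
  simp only [Sigma.mk.injEq, heq_eq_eq, true_and, Prod.mk.injEq] at this
  simp only [this.2]

/-- The Cuntz-Krieger family on `H_x` given by translation of classes. -/
def family (hrow : IsRowFinite k Λ) : CKFamily k Λ (x.H →L[ℂ] x.H) where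
  t f := pequivOp (x.shift f)
  partialIsometry {w v} f := by
    rw [star_pequivOp, mul_assoc, ← pequivOp_trans, shift_trans_symm, ← pequivOp_trans,
      ← shift_comp, Category.id_comp]
  ck1_star v := by rw [star_pequivOp, shift_id_symm]
  ck1_idem v := by rw [← pequivOp_trans, ← shift_comp, Category.id_comp]
  ck1_orth v w h := by
    rw [← pequivOp_trans, ← pequivOp_bot]
    congr 1
    refine PEquiv.ext fun c => ?_
    obtain ⟨i, b, μ, rfl⟩ := x.exists_cls c
    change (x.shift (𝟙 w) (x.cls i μ)).bind (x.shift (𝟙 v)) = none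
    by_cases hb : w = b
    · subst hb
      rw [shift_cls, Option.bind_some, shift_cls_of_ne _ _ _ h]
    · rw [shift_cls_of_ne _ _ _ hb, Option.bind_none]
  ck2 g f := by rw [← pequivOp_trans, ← shift_comp]
  ck3 f := by rw [star_pequivOp, ← pequivOp_trans, shift_trans_symm]
  ck4 v n := by
    classical
    have := hrow v n
    have := Fintype.ofFinite (PathsTo k v n)
    rw [finsum_eq_sum_of_fintype]
    ext h c
    rw [_root_.sum_apply, lp.coeFn_sum, Finset.sum_apply]
    simp only [star_pequivOp, mul_apply_eq_comp, pequivOp_apply]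
    obtain ⟨i, b, μ, rfl⟩ := x.exists_cls c
    by_cases hb : v = b
    · subst hb
      rw [shift_id_symm, shift_cls, Category.comp_id]
      obtain ⟨p, j, ν, hp⟩ := x.exists_pathsTo_of_cls μ n
      -- Only the unique path `p` of degree `n` through which the class factors contributes at this
      -- coordinate.
      rw [Finset.sum_eq_single p]
      · rw [hp, (x.shift p.2.1).eq_some_iff.2 (x.shift_cls p.2.1 ν)]
        simp only [Option.elim, pequivOp_apply, PEquiv.symm_symm, shift_cls]
      · intro q _ hqp
        cases hq : (x.shift q.2.1).symm (x.cls i μ) with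
        | none => rfl
        | some c' =>
          obtain ⟨l, ρ, -, h2⟩ := x.mem_shift.1 ((x.shift q.2.1).eq_some_iff.1 hq)
          exact absurd (x.pathsTo_eq_of_cls_eq (h2.symm.trans hp)) hqp
      · exact fun h => absurd (Finset.mem_univ p) h
    · rw [shift_id_symm, shift_cls_of_ne _ _ _ hb]
      refine (Finset.sum_eq_zero fun q _ => ?_).symm
      cases hq : (x.shift q.2.1).symm (x.cls i μ) with
      | none => rfl
      | some c' =>
        obtain ⟨l, ρ, -, h2⟩ := x.mem_shift.1 ((x.shift q.2.1).eq_some_iff.1 hq)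
        exact absurd (x.range_eq_of_cls_eq h2).symm hb

/-- The representation of `C*(Λ)` on `H_x`. -/
def pathRep (hrow : IsRowFinite k Λ) : CStar k Λ →⋆ₙₐ[ℂ] (x.H →L[ℂ] x.H) :=
  coord k Λ ⟨x.H →L[ℂ] x.H, x.family hrow⟩

theorem pathRep_gen (hrow : IsRowFinite k Λ) {w v : Λ} (f : w ⟶ v) :
    x.pathRep hrow (gen k f) = pequivOp (x.shift f) := rfl

theorem isPathRepresentation_pathRep (hrow : IsRowFinite k Λ) :
    x.IsPathRepresentation (x.pathRep hrow) := by
  refine ⟨fun f i μ => ?_, fun f i μ h => ?_⟩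
  · rw [pathRep_gen, ξ, pequivOp_basisVec]
    change (x.shift f (x.cls i μ)).elim 0 basisVec = _
    rw [shift_cls]
    rfl
  · rw [pathRep_gen, ξ, pequivOp_basisVec]
    change (x.shift f (x.cls i μ)).elim 0 basisVec = _
    rw [shift_cls_of_ne _ _ _ h]
    rfl

/-- The projection fixes the basis vector of the trivial path at `x(0)`, since `x.vertex 0` and
`x.range` are the same vertex by definition. -/
theorem pathRep_range_ne_zero (hrow : IsRowFinite k Λ) :
    x.pathRep hrow (gen k (𝟙 x.range)) ≠ 0 := by
  intro h
  have h1 := (x.isPathRepresentation_pathRep hrow).1 (𝟙 x.range) 0 (𝟙 (x.vertex 0))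
  rw [h] at h1
  have h2 := congrArg (fun u : x.H => u (x.cls 0 (𝟙 (x.vertex 0) ≫ 𝟙 x.range))) h1
  exact zero_ne_one (h2.trans (basisVec_apply_self _))

/-- The `ℤ^k`-valued degree of a class: `d(μ) - (i, …, i)` for `μ ∈ F_i`. -/
def clsDeg : x.GenClass → (Fin k → ℤ) :=
  Quotient.lift (s := x.genSetoid) (fun p => fun l => (deg k p.2.2 l : ℤ) - p.1) (by
    -- Passing from `i` to `j` adds `j - i` to every coordinate of the degree, which the subtracted
    -- diagonal term compensates.
    have key : ∀ (i j : ℕ) (h : i ≤ j) (μ : x.F i),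
        (fun l => (deg k μ.2 l : ℤ) - i) = fun l => (deg k (x.extend h μ).2 l : ℤ) - j := by
      intro i j h μ
      funext l
      have h1 : deg k (x.extend h μ).2 = deg k μ.2 + fun _ => j - i := by
        rw [← x.deg_seg h]
        exact degree_comp _ _
      rw [h1]
      simp only [Pi.add_apply]
      omega
    rintro ⟨i, μ⟩ ⟨j, ν⟩ (⟨h, e⟩ | ⟨h, e⟩)
    · simp only at h e ⊢
      rw [e, ← key]
    · simp only at h e ⊢
      rw [e, ← key])

theorem clsDeg_cls {i : ℕ} {v : Λ} (μ : x.vertex i ⟶ v) :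
    x.clsDeg (x.cls i μ) = zdeg k μ - fun _ => (i : ℤ) := rfl

theorem clsDeg_shift {w v : Λ} {f : w ⟶ v} {c c' : x.GenClass} (h : x.shift f c = some c') :
    x.clsDeg c' = x.clsDeg c + zdeg k f := by
  obtain ⟨i, μ, rfl, rfl⟩ := x.mem_shift.1 h
  rw [clsDeg_cls, clsDeg_cls, zdeg_comp]
  abel

/-- Averaging over the gauge action removes the matrix coefficients of non-zero degree. -/
theorem pathRep_gaugeMean_basisVec (hrow : IsRowFinite k Λ) (a : CStar k Λ) (c d : x.GenClass) :
    x.pathRep hrow (gaugeMean hrow a) (basisVec d) c =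
      if x.clsDeg c = x.clsDeg d then x.pathRep hrow a (basisVec d) c else 0 := by
  have hev : Continuous fun a : CStar k Λ => x.pathRep hrow a (basisVec d) c :=
    (lp.evalCLM ℂ (fun _ : x.GenClass => ℂ) (p := 2) c).continuous.comp
      ((continuous_starHom (x.pathRep hrow)).clm_apply continuous_const)
  induction a using CStar.induction_on hrow with
  | hcl =>
    refine isClosed_eq (hev.comp (gaugeMean hrow).continuous) ?_
    split_ifs
    exacts [hev, continuous_const]
  | hmono p q =>
    rw [gaugeMean_mono]
    have hq : x.pathRep hrow (gen k p.2.2 * star (gen k q.2.2)) =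
        pequivOp ((x.shift q.2.2).symm.trans (x.shift p.2.2)) := by
      rw [map_mul, map_star, pathRep_gen, pathRep_gen, star_pequivOp, pequivOp_trans]
    -- The monomial `t_p t_q*` sends the class `d` to zero or to one class, of degree shifted by
    -- `d(p) - d(q)`. It thus has no coefficients between different degrees if `d(p) = d(q)`, and
    -- none within one degree otherwise.
    have hz : x.clsDeg c ≠ x.clsDeg d + zdeg k p.2.2 - zdeg k q.2.2 →
        x.pathRep hrow (gen k p.2.2 * star (gen k q.2.2)) (basisVec d) c = 0 := by
      classical
      intro hne
      rw [hq, pequivOp_basisVec]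
      cases he : (x.shift q.2.2).symm.trans (x.shift p.2.2) d with
      | none => rfl
      | some c' =>
        obtain ⟨b, h1, h2⟩ := (PEquiv.trans_eq_some _ _ _ _).1 he
        have h3 := x.clsDeg_shift ((x.shift q.2.2).eq_some_iff.1 h1)
        have h4 := x.clsDeg_shift h2
        have : c ≠ c' := by
          rintro rfl
          exact hne (by rw [h4, h3]; abel)
        simp [basisVec, lp.single_apply, this]
    by_cases hd : deg k p.2.2 = deg k q.2.2
    · rw [if_pos hd]
      split_ifs with h
      · rfl
      · exact hz fun h' => h (by rw [h', zdeg_inj.2 hd]; abel)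
    · rw [if_neg hd]
      split_ifs with h
      · rw [map_zero, hz]
        · rfl
        · intro h'
          rw [h, add_sub_assoc, left_eq_add, sub_eq_zero, zdeg_inj] at h'
          exact hd h'
      · rw [map_zero]
        rfl
  | hzero => simp
  | hadd a b ha hb =>
    simp only [map_add, _root_.add_apply, lp.coeFn_add, Pi.add_apply, ha, hb]
    split_ifs <;> simp
  | hsmul r a ha =>
    simp only [map_smul, _root_.smul_apply, lp.coeFn_smul, Pi.smul_apply, ha]
    split_ifs <;> simp

theorem pathRep_gaugeMean_eq_zero (hrow : IsRowFinite k Λ) {a : CStar k Λ}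
    (h : x.pathRep hrow a = 0) : x.pathRep hrow (gaugeMean hrow a) = 0 := by
  refine ContinuousLinearMap.ext_on (dense_span_basisVec x.GenClass) ?_
  rintro _ ⟨d, rfl⟩
  refine lp.ext (funext fun c => ?_)
  rw [pathRep_gaugeMean_basisVec, h]
  simp

end InfinitePath

end PathRepresentations

/-! ### Direct sums of representations and separability -/

section Sums

section HilbertSum

/-- A countable Hilbert sum of separable spaces is separable. -/
theorem separableSpace_lp_two {ι : Type*} [Countable ι] {E : ι → Type*}
    [∀ i, NormedAddCommGroup (E i)] [∀ i, TopologicalSpace.SeparableSpace (E i)]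
    [∀ i, NormedSpace ℂ (E i)] : TopologicalSpace.SeparableSpace (lp E 2) := by
  classical
  have h1 : TopologicalSpace.IsSeparable (⋃ i, Set.range (lp.single (E := E) 2 i)) :=
    .iUnion fun i => TopologicalSpace.isSeparable_range (lp.isometry_single i).continuous
  have h2 := (h1.span (R := ℂ)).closure
  rw [← TopologicalSpace.isSeparable_univ_iff]
  refine h2.mono fun f _ => mem_closure_of_tendsto (lp.hasSum_single (by norm_num) f)
    (Filter.Eventually.of_forall fun s => Submodule.sum_mem _ fun i _ => ?_)
  exact Submodule.subset_span (Set.mem_iUnion.2 ⟨i, f i, rfl⟩)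

variable {ι : Type*} {E : ι → Type*} [∀ i, NormedAddCommGroup (E i)]
  [∀ i, InnerProductSpace ℂ (E i)]

/-- A bound uniform in `s` serves both for membership in the Hilbert sum and for the operator norm
of `sumOp`. -/
theorem sum_map_le {C : ℝ} (hC : 0 ≤ C) {T : ∀ i, E i →L[ℂ] E i} (hT : ∀ i, ‖T i‖ ≤ C)
    (h : lp E 2) (s : Finset ι) :
    ∑ i ∈ s, ‖T i (h i)‖ ^ (2 : ℝ≥0∞).toReal ≤ (C * ‖h‖) ^ (2 : ℝ≥0∞).toReal := by
  have h2 : (0 : ℝ) < (2 : ℝ≥0∞).toReal := by norm_num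
  calc ∑ i ∈ s, ‖T i (h i)‖ ^ (2 : ℝ≥0∞).toReal
      ≤ ∑ i ∈ s, C ^ (2 : ℝ≥0∞).toReal * ‖h i‖ ^ (2 : ℝ≥0∞).toReal := by
        refine Finset.sum_le_sum fun i _ => ?_
        rw [← Real.mul_rpow hC (norm_nonneg _)]
        exact Real.rpow_le_rpow (norm_nonneg _) ((T i).le_of_opNorm_le (hT i) _) h2.le
    _ ≤ _ := by
        rw [← Finset.mul_sum, Real.mul_rpow hC (norm_nonneg _)]
        exact mul_le_mul_of_nonneg_left (lp.sum_rpow_le_norm_rpow h2 h s)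
          (Real.rpow_nonneg hC _)

/-- The direct sum of a bounded family of operators. -/
def sumOp (T : ∀ i, E i →L[ℂ] E i) (C : ℝ) (hC : 0 ≤ C) (hT : ∀ i, ‖T i‖ ≤ C) :
    lp E 2 →L[ℂ] lp E 2 :=
  LinearMap.mkContinuous
    { toFun := fun h => ⟨fun i => T i (h i), memℓp_gen' (sum_map_le hC hT h)⟩
      map_add' := fun g h => lp.ext (funext fun i => (T i).map_add (g i) (h i))
      map_smul' := fun a h => lp.ext (funext fun i => (T i).map_smul a (h i)) } C fun h =>
    lp.norm_le_of_forall_sum_le (by norm_num) (mul_nonneg hC (norm_nonneg h))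
      (sum_map_le hC hT h)

theorem sumOp_apply (T : ∀ i, E i →L[ℂ] E i) (C : ℝ) (hC : 0 ≤ C) (hT : ∀ i, ‖T i‖ ≤ C)
    (h : lp E 2) (i : ι) : sumOp T C hC hT h i = T i (h i) := rfl

/-- The direct sum of a family of representations of a C*-algebra. -/
def sumRep [∀ i, CompleteSpace (E i)] {A : Type*} [NonUnitalCStarAlgebra A]
    (ρ : ∀ i, A →⋆ₙₐ[ℂ] (E i →L[ℂ] E i)) : A →⋆ₙₐ[ℂ] (lp E 2 →L[ℂ] lp E 2) where
  toFun a := sumOp (fun i => ρ i a) ‖a‖ (norm_nonneg a)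
    fun i => NonUnitalStarAlgHom.norm_apply_le (ρ i) a
  map_smul' c a := by
    ext h i
    change ρ i (c • a) (h i) = c • ρ i a (h i)
    rw [map_smul]; rfl
  map_zero' := by
    ext h i
    change ρ i 0 (h i) = 0
    rw [map_zero]; rfl
  map_add' a b := by
    ext h i
    change ρ i (a + b) (h i) = ρ i a (h i) + ρ i b (h i)
    rw [map_add]; rfl
  map_mul' a b := by
    ext h i
    change ρ i (a * b) (h i) = ρ i a (ρ i b (h i))
    rw [map_mul]; rfl
  map_star' a := by
    rw [ContinuousLinearMap.star_eq_adjoint, ContinuousLinearMap.eq_adjoint_iff]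
    intro g h
    rw [lp.inner_eq_tsum, lp.inner_eq_tsum]
    refine tsum_congr fun i => ?_
    rw [sumOp_apply, sumOp_apply, map_star, ContinuousLinearMap.star_eq_adjoint,
      ContinuousLinearMap.adjoint_inner_left]

theorem sumRep_apply [∀ i, CompleteSpace (E i)] {A : Type*} [NonUnitalCStarAlgebra A]
    (ρ : ∀ i, A →⋆ₙₐ[ℂ] (E i →L[ℂ] E i)) (a : A) (h : lp E 2) (i : ι) :
    sumRep ρ a h i = ρ i a (h i) := rfl

theorem sumRep_eq_zero_iff [∀ i, CompleteSpace (E i)] {A : Type*} [NonUnitalCStarAlgebra A]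
    (ρ : ∀ i, A →⋆ₙₐ[ℂ] (E i →L[ℂ] E i)) (a : A) : sumRep ρ a = 0 ↔ ∀ i, ρ i a = 0 := by
  classical
  constructor
  · intro h i
    ext e
    have h1 := congrArg (fun T : lp E 2 →L[ℂ] lp E 2 => T (lp.single 2 i e) i) h
    simp only [sumRep_apply, lp.single_apply_self] at h1
    exact h1
  · intro h
    ext e i
    rw [sumRep_apply, h]
    rfl

end HilbertSum

variable {k : ℕ} {Λ : Type u} [SmallCategory Λ] [HigherRankGraph k Λ]

theorem InfinitePath.countable_genClass (x : InfinitePath k Λ) : Countable x.GenClass := by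
  have := countable_obj k (Λ := Λ)
  have := countable_hom k (Λ := Λ)
  infer_instance

end Sums

end HigherRankGraph

end

/-! ### The main theorem -/

theorem mainTheorem1 (k : ℕ) (hk : 1 ≤ k) (Λ : Type u) [SmallCategory Λ] [HigherRankGraph k Λ]
    (hrow : HigherRankGraph.IsRowFinite k Λ) (hsrc : HigherRankGraph.IsSourceFree k Λ) :
    (∃ y : Λ → HigherRankGraph.InfinitePath k Λ, ∀ v, (y v).range = v) ∧
    ∀ y : Λ → HigherRankGraph.InfinitePath k Λ, (∀ v, (y v).range = v) →
      TopologicalSpace.SeparableSpace (HigherRankGraph.SumSpace y) ∧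
      ∃ (πy : ∀ v, HigherRankGraph.CStar k Λ →⋆ₙₐ[ℂ] ((y v).H →L[ℂ] (y v).H))
        (π : HigherRankGraph.CStar k Λ →⋆ₙₐ[ℂ]
          (HigherRankGraph.SumSpace y →L[ℂ] HigherRankGraph.SumSpace y)),
        (∀ v, (y v).IsPathRepresentation (πy v)) ∧
        (∀ (a : HigherRankGraph.CStar k Λ) (h : HigherRankGraph.SumSpace y) (v : Λ),
          π a h v = πy v a (h v)) ∧
        Function.Injective π := by
  open HigherRankGraph in
  refine ⟨Classical.skolem.1 (exists_infinitePath hsrc), fun y hy => ⟨?_, ?_⟩⟩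
  · have := countable_obj k (Λ := Λ)
    have := fun v => (y v).countable_genClass
    have : ∀ v, TopologicalSpace.SeparableSpace (y v).H := fun v => separableSpace_lp_two
    exact separableSpace_lp_two
  · refine ⟨fun v => (y v).pathRep hrow, sumRep fun v => (y v).pathRep hrow,
      fun v => (y v).isPathRepresentation_pathRep hrow, fun a h v => rfl,
      injective_of_gaugeMean hrow _ (fun v h0 => ?_) fun a ha => ?_⟩
    -- The condition `r(y_v) = v` enters here: the summand at `v` detects the projection `t_v`.
    · have h1 := (y v).pathRep_range_ne_zero hrow
      rw [hy v] at h1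
      exact h1 ((sumRep_eq_zero_iff _ _).1 h0 v)
    -- The kernel of the sum is the intersection of the kernels of the summands, each stable under
    -- averaging.
    · exact (sumRep_eq_zero_iff _ _).2 fun v =>
        (y v).pathRep_gaugeMean_eq_zero hrow ((sumRep_eq_zero_iff _ _).1 ha v)
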